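/- Theorem 1.5 (Second Main Theorem: Displacement formula). Let $B:\mathbb{R}^3\to\mathbb{R}^3$ be a $C^3$ vector field, all of whose derivatives up to order $3$ (including $B$ itself) are bounded on $\mathbb{R}^3$, which vanishes nowhere and is divergence-free on $\mathbb{R}^3$. Suppose that $\Omega\subset\mathbb{R}^3$ is a bounded domain (open and connected) with $\partial\Omega\in C^3$ and that $p\in C^3(\overline{\Omega})$ is a real-valued function such that $$\operatorname{div}(B)=0,\qquad B\times\operatorname{curl}(B)=\nabla p\quad\text{in }\Omega,\qquad B\text{ and }\operatorname{curl}(B)\text{ are tangent to }\partial\Omega .$$ Write $b:=B/|B|$. Then there is a constant $c>0$ (depending only on $B$, $\Omega$ and $p$) such that for all $x_0\in\Omega$ and $v_0\in\mathbb{R}^3$ the following holds. For every $\omega>0$ the initial value problem $\ddot x_\omega=\omega\,\dot x_\omega\times B(x_\omega)$, $x_\omega(0)=x_0$, $\dot x_\omega(0)=v_0$, has a unique solution $x_\omega:\mathbb{R}\to\mathbb{R}^3$; put $v_\omega:=\dot x_\omega$. As $\omega\to\infty$, $x_\omega$ converges in $C^{0,\alpha}([0,T])$, for all $0\le\alpha<1$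 and all $0<T<\infty$, to a limit trajectory $x$, which satisfies $\dot x(t)=h(t)\,b(x(t))$ for all $t\ge 0$ with a function $h:[0,\infty)\to\mathbb{R}$, and $x(t)\in\Omega$ for all $t\geq 0$. Let $$\mu_0:=\frac{|v_0|^2-h(0)^2}{2|B(x(0))|}$$ be the magnetic moment. Then there is a constant $C>0$, independent of $t$ and $\omega$, such that for all $\omega>0$ and $t\ge0$ for which $x_\omega(s)\in\Omega$ for all $0\le s\le t$, $$p(x_\omega(t))=p(x_0)+\frac{(b(x(t))\times v_\omega(t))\cdot\nabla p(x(t))}{|B(x(t))|\,\omega}-\frac{(b(x_0)\times v_0)\cdot\nabla p(x_0)}{\omega|B(x_0)|}$$ $$+\frac1\omega\int_0^t\left(\frac{|v_0|^2}{|B(x(s))|}-\mu_0\right)(B(x(s))\times\nabla p(x(s)))\cdot\nabla(|B|^{-1})(x(s))\,ds+R_\omega(t),$$ $$\text{where}\quad |R_\omega(t)|\le\frac{c}{\omega^2}\exp\left(C\exp(Ct^2)\right).$$ -/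

import Mathlib

open Filter Topology Set
open scoped NNReal

noncomputable section

/-- Euclidean three-space. -/
abbrev E3 : Type := EuclideanSpace ℝ (Fin 3)

/-- The cross product on Euclidean three-space. -/
def cross (u v : E3) : E3 := WithLp.toLp 2 (crossProduct u.ofLp v.ofLp)

/-- The partial derivative `∂ᵢ Bⱼ` of a vector field at `y`. -/
def partialDeriv (B : E3 → E3) (i j : Fin 3) (y : E3) : ℝ :=
  (fderiv ℝ B y (EuclideanSpace.single i 1)) j

/-- The divergence of a vector field. -/
def divergence (B : E3 → E3) (y : E3) : ℝ := ∑ i, partialDeriv B i i y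

/-- The curl of a vector field (coordinates numbered `0, 1, 2`). -/
def curl (B : E3 → E3) (y : E3) : E3 :=
  !₂[partialDeriv B 1 2 y - partialDeriv B 2 1 y,
     partialDeriv B 2 0 y - partialDeriv B 0 2 y,
     partialDeriv B 0 1 y - partialDeriv B 1 0 y]

/-- The unit field `b = B / |B|`. -/
def unitField (B : E3 → E3) (y : E3) : E3 := ‖B y‖⁻¹ • B y

/-- `B ∈ C^k(ℝ³, ℝ³)` with all derivatives of order at most `k` bounded on the whole space. -/
def IsBoundedCk (k : ℕ) (B : E3 → E3) : Prop :=
  ContDiff ℝ k B ∧ ∀ j ≤ k, ∃ M : ℝ, ∀ y, ‖iteratedFDeriv ℝ j B y‖ ≤ M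

/-- `ρ` is a `C^k` defining function of the open set `Ω` on the open neighbourhood `U` of `z`:
inside `U`, the set `Ω` is `{ρ < 0}`, and `dρ` does not vanish. -/
structure IsLocalDefiningFunction (k : ℕ) (Ω : Set E3) (z : E3) (U : Set E3) (ρ : E3 → ℝ) :
    Prop where
  isOpen : IsOpen U
  mem : z ∈ U
  contDiffOn : ContDiffOn ℝ k ρ U
  fderiv_ne_zero : ∀ y ∈ U, fderiv ℝ ρ y ≠ 0
  inter_eq : Ω ∩ U = {y ∈ U | ρ y < 0}

/-- `∂Ω ∈ C^k`: every boundary point has a local `C^k` defining function. -/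
def HasCkBoundary (k : ℕ) (Ω : Set E3) : Prop :=
  ∀ z ∈ frontier Ω, ∃ U ρ, IsLocalDefiningFunction k Ω z U ρ

/-- `F ∥ ∂Ω`: at each boundary point `z` the vector `F z` lies in the tangent space of `∂Ω`, which
is the kernel of `dρ(z)` for any local defining function `ρ`. -/
def IsTangentToBoundary (Ω : Set E3) (F : E3 → E3) : Prop :=
  ∀ z ∈ frontier Ω, ∀ U ρ, IsLocalDefiningFunction 1 Ω z U ρ → fderiv ℝ ρ z (F z) = 0

/-- The plasma equilibrium equations on `Ω` for the magnetic field `B` and the pressure `p`. -/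
structure IsPlasmaEquilibrium (Ω : Set E3) (B : E3 → E3) (p : E3 → ℝ) : Prop where
  div_eq_zero : ∀ y ∈ Ω, divergence B y = 0
  force_balance : ∀ y ∈ Ω, cross (B y) (curl B y) = gradient p y
  field_tangent : IsTangentToBoundary Ω B
  current_tangent : IsTangentToBoundary Ω (curl B)

/-- `X` solves `X'' = ω X' × B(X)` on the whole line with `X(0) = x₀` and `X'(0) = v₀`. -/
structure IsParticlePath (B : E3 → E3) (ω : ℝ) (x₀ v₀ : E3) (X : ℝ → E3) : Prop where
  differentiable : Differentiable ℝ X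
  equation : ∀ t, HasDerivAt (deriv X) (ω • cross (deriv X t) (B (X t))) t
  position_zero : X 0 = x₀
  velocity_zero : deriv X 0 = v₀

/-- `X ω → x` as `ω → ∞` in `C^{0,α}([0,T])` for all `0 ≤ α < 1` and all `0 < T < ∞`: both the sup
norm and the `α`-Hölder seminorm of `X ω - x` on `[0,T]` tend to zero. -/
def TendstoHolderLoc (X : ℝ → ℝ → E3) (x : ℝ → E3) : Prop :=
  ∀ α : ℝ≥0, α < 1 → ∀ T : ℝ, 0 < T → ∀ ε : ℝ≥0, 0 < ε → ∀ᶠ ω in atTop,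
    (∀ t ∈ Icc 0 T, ‖X ω t - x t‖ ≤ ε) ∧ HolderOnWith ε α (fun t => X ω t - x t) (Icc 0 T)

/-- `x` is the limit trajectory of the family `X ω`, and it moves along the field lines of `B` with
parallel speed `h`, that is, `x' = h b(x)` on `[0,∞)`. -/
structure IsLimitTrajectory (B : E3 → E3) (X : ℝ → ℝ → E3) (x : ℝ → E3) (h : ℝ → ℝ) :
    Prop where
  tendsto : TendstoHolderLoc X x
  hasDerivWithinAt : ∀ t, 0 ≤ t → HasDerivWithinAt x (h t • unitField B (x t)) (Ici 0) t

/-- The magnetic moment `μ(t) = (|v₀|² - h(t)²) / (2 |B(x(t))|)`. -/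
def magneticMoment (B : E3 → E3) (v₀ : E3) (x : ℝ → E3) (h : ℝ → ℝ) (t : ℝ) : ℝ :=
  (‖v₀‖ ^ 2 - h t ^ 2) / (2 * ‖B (x t)‖)

/-- The oscillating term `((b(y) × v) · ∇p(y)) / |B(y)|`. -/
def gyroTerm (B : E3 → E3) (p : E3 → ℝ) (y v : E3) : ℝ :=
  inner ℝ (cross (unitField B y) v) (gradient p y) / ‖B y‖

/-- The drift density `(|v₀|² / |B(y)| - μ₀) (B(y) × ∇p(y)) · ∇(|B|⁻¹)(y)`. -/
def driftDensity (B : E3 → E3) (p : E3 → ℝ) (v₀ : E3) (μ₀ : ℝ) (y : E3) : ℝ :=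
  (‖v₀‖ ^ 2 / ‖B y‖ - μ₀) *
    inner ℝ (cross (B y) (gradient p y)) (gradient (fun z => ‖B z‖⁻¹) y)

end

/-! Write `V = X'` and `b = B/|B|`. Along a path, `d/dt F(X,V) = D_x F·V + ω D_v F·(V × B)`. Since
`|V|` is constant, the integral of `D_v F·(V × B)` is `O((1+t)/ω)` while `X` stays in a compact set
(`exists_norm_integral_fderiv_cross_le`). So whatever has the form `D_v F·(v × B)`, a derivative
along the gyration about `b`, averages out. Explicit primitives `F` treat the transversal velocity
and the difference between a quadratic form `v·A(x)v` and its `gyroAverage`.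

Guiding centre: the parallel velocity `u = b·V` satisfies `u' = V·Db(V)`, free of `ω`, and by `div B
= 0` the mean of the right side is `mirrorForce`. Up to oscillating terms, `(X,u)` thus solves `x' =
h b(x)`, `h' = mirrorForce`, and Gronwall bounds its distance to `(x,h)` by `(C/ω) exp(Ct)`. The
limit system conserves the magnetic moment, and `x` stays in `Ω` because `b` is tangent to the
boundary.

Pressure: in `Ω`, `∇p = P := B × curl B`, and `K = |B|⁻² P × B` (`perpCurrent`) satisfies `K·(v × B)
= P·v`. Hence `(K·V)' = V·DK(V) + ω (p(X))'`: exactly, `ω (p(X_t) - p(x₀))` is the increment of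
`K·V` minus `∫ V·DK(V)`. As `DP` is the Hessian of `p`, the mean of `V·DK(V)` is minus the drift
density. Averaging and then replacing `X` by `x` each cost `O(1/ω)`, and dividing by `ω` gives the
remainder of order `1/ω²`. Its growth in time, `(1+t) exp(Ct)`, lies well below the double
exponential. -/

/-! ### Algebra of the cross product. -/

/-- The cross product as a continuous bilinear map. -/
noncomputable def crossL : E3 →L[ℝ] E3 →L[ℝ] E3 :=
  LinearMap.toContinuousLinearMap
    ((LinearMap.toContinuousLinearMap : (E3 →ₗ[ℝ] E3) ≃ₗ[ℝ] (E3 →L[ℝ] E3)).toLinearMap ∘ₗ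
      LinearMap.mk₂ ℝ cross
        (fun u v w => by simp [cross]) (fun c u v => by simp [cross])
        (fun u v w => by simp [cross]) (fun c u v => by simp [cross]))

theorem crossL_apply (u v : E3) : crossL u v = cross u v := rfl

theorem cross_zero_apply (u v : E3) : cross u v 0 = u 1 * v 2 - u 2 * v 1 := by
  simp [cross, cross_apply]

theorem cross_one_apply (u v : E3) : cross u v 1 = u 2 * v 0 - u 0 * v 2 := by
  simp [cross, cross_apply]

theorem cross_two_apply (u v : E3) : cross u v 2 = u 0 * v 1 - u 1 * v 0 := by
  simp [cross, cross_apply]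

theorem inner_eq_coord (u v : E3) : inner ℝ u v = u 0 * v 0 + u 1 * v 1 + u 2 * v 2 := by
  simp [PiLp.inner_apply, Fin.sum_univ_three, mul_comm]

theorem norm_sq_eq_coord (u : E3) : ‖u‖ ^ 2 = u 0 ^ 2 + u 1 ^ 2 + u 2 ^ 2 := by
  rw [← real_inner_self_eq_norm_sq, inner_eq_coord]; ring

theorem ext_coord {u v : E3} (h0 : u 0 = v 0) (h1 : u 1 = v 1) (h2 : u 2 = v 2) : u = v := by
  ext i; fin_cases i <;> assumption

/-- Turns vector identities involving a derivative into polynomial identities in its matrix entries.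
-/
theorem clm_apply_coord (A : E3 →L[ℝ] E3) (v : E3) (j : Fin 3) :
    A v j = v 0 * A (EuclideanSpace.single 0 1) j + v 1 * A (EuclideanSpace.single 1 1) j
      + v 2 * A (EuclideanSpace.single 2 1) j := by
  have hv : v = v 0 • EuclideanSpace.single 0 1 + v 1 • EuclideanSpace.single 1 1
      + v 2 • (EuclideanSpace.single 2 1 : E3) := by
    apply ext_coord <;> simp
  conv_lhs => rw [hv]
  simp

theorem inner_cross_self_left (u v : E3) : inner ℝ u (cross u v) = 0 := by
  simp only [inner_eq_coord, cross_zero_apply, cross_one_apply, cross_two_apply]; ring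

theorem inner_cross_self_right (u v : E3) : inner ℝ v (cross u v) = 0 := by
  simp only [inner_eq_coord, cross_zero_apply, cross_one_apply, cross_two_apply]; ring

theorem inner_cross_cross (a b c d : E3) :
    inner ℝ (cross a b) (cross c d) =
      inner ℝ a c * inner ℝ b d - inner ℝ a d * inner ℝ b c := by
  simp only [inner_eq_coord, cross_zero_apply, cross_one_apply, cross_two_apply]; ring

theorem cross_cross_right (a v : E3) :
    cross a (cross v a) = inner ℝ a a • v - inner ℝ a v • a := by
  apply ext_coord <;>
    simp only [inner_eq_coord, cross_zero_apply, cross_one_apply, cross_two_apply,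
      PiLp.sub_apply, PiLp.smul_apply, smul_eq_mul] <;> ring

theorem cross_swap (u v : E3) : cross u v = -cross v u := by
  apply ext_coord <;>
    simp only [cross_zero_apply, cross_one_apply, cross_two_apply, PiLp.neg_apply] <;> ring

theorem cross_smul_right (c : ℝ) (u v : E3) : cross u (c • v) = c • cross u v := by
  simp only [← crossL_apply, map_smul]

theorem cross_smul_left (c : ℝ) (u v : E3) : cross (c • u) v = c • cross u v := by
  simp only [← crossL_apply, map_smul, smul_apply]

theorem ContDiff.cross {E : Type*} [NormedAddCommGroup E] [NormedSpace ℝ E] {n : WithTop ℕ∞}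
    {f g : E → E3} (hf : ContDiff ℝ n f) (hg : ContDiff ℝ n g) :
    ContDiff ℝ n fun y => cross (f y) (g y) :=
  (crossL.contDiff.comp hf).clm_apply hg

theorem Continuous.cross {E : Type*} [TopologicalSpace E] {f g : E → E3} (hf : Continuous f)
    (hg : Continuous g) : Continuous fun y => cross (f y) (g y) :=
  (crossL.continuous.comp hf).clm_apply hg

/-! ### Complete integral curves and Gronwall's inequality. -/

/-- A `C¹` map is Lipschitz on compact sets. -/
theorem ContDiff.exists_lipschitzOnWith_of_isCompact {E F : Type*} [NormedAddCommGroup E]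
    [NormedSpace ℝ E] [NormedAddCommGroup F] [NormedSpace ℝ F] {f : E → F}
    (hf : ContDiff ℝ 1 f) {D : Set E} (hD : IsCompact D) : ∃ L, LipschitzOnWith L f D :=
  (hf.locallyLipschitz.locallyLipschitzOn (s := D)).exists_lipschitzOnWith_of_compact hD

/-- A bounded `C¹` vector field has a complete integral curve through every point. -/
theorem exists_integral_curve_of_bounded {E : Type*} [NormedAddCommGroup E] [NormedSpace ℝ E]
    [ProperSpace E] [CompleteSpace E] {f : E → E} (hf : ContDiff ℝ 1 f) {M : ℝ}
    (hM : ∀ y, ‖f y‖ ≤ M) (y₀ : E) :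
    ∃ γ : ℝ → E, γ 0 = y₀ ∧ ∀ t, HasDerivAt γ (f (γ t)) t := by
  have hM0 : 0 ≤ M := (norm_nonneg _).trans (hM y₀)
  -- A curve of speed at most `M` stays in the ball of radius `M * a` up to time `a`, so
  -- Picard–Lindelöf on that ball reaches the whole interval.
  have key : ∀ a : ℝ, ∃ γ : ℝ → E, γ 0 = y₀ ∧ ∀ t ∈ Ioo (-a) a, HasDerivAt γ (f (γ t)) t := by
    intro a
    rcases le_or_gt a 0 with ha | ha
    · exact ⟨fun _ => y₀, rfl, fun t ht => by linarith [ht.1, ht.2]⟩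
    obtain ⟨K, hK⟩ := hf.exists_lipschitzOnWith_of_isCompact
      (isCompact_closedBall y₀ (M * a))
    have hpl : IsPicardLindelof (fun _ : ℝ => f) (tmin := -a) (tmax := a)
        ⟨0, by constructor <;> linarith⟩ y₀ ⟨M * a, by positivity⟩ 0 ⟨M, hM0⟩ K := by
      refine .of_time_independent (fun x _ => hM x) hK ?_
      change M * max (a - 0) (0 - -a) ≤ M * a - 0
      simp
    obtain ⟨γ, h0, hγ⟩ := hpl.exists_eq_forall_mem_Icc_hasDerivWithinAt₀
    exact ⟨γ, h0, fun t ht => (hγ t (Ioo_subset_Icc_self ht)).hasDerivAt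
      (Icc_mem_nhds ht.1 ht.2)⟩
  choose γ h0 hγ using key
  have mem : ∀ a t, t ∈ Ioo (-a) a → γ a t ∈ Metric.closedBall y₀ (M * a) := by
    intro a t ht
    have ha : 0 < a := by linarith [ht.1, ht.2]
    have := (convex_Ioo (-a) a).norm_image_sub_le_of_norm_hasDerivWithin_le
      (fun s hs => (hγ a s hs).hasDerivWithinAt) (fun s _ => hM (γ a s))
      (⟨by linarith, ha⟩ : (0 : ℝ) ∈ Ioo (-a) a) ht
    rw [h0, sub_zero] at this
    rw [mem_closedBall_iff_norm]
    exact this.trans (mul_le_mul_of_nonneg_left (abs_lt.2 ht).le hM0)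
  have agree : ∀ a a' : ℝ, 0 < a → a ≤ a' → EqOn (γ a) (γ a') (Ioo (-a) a) := by
    intro a a' ha haa
    obtain ⟨K, hK⟩ := hf.exists_lipschitzOnWith_of_isCompact
      (isCompact_closedBall y₀ (M * a'))
    have hsub : Ioo (-a) a ⊆ Ioo (-a') a' := Ioo_subset_Ioo (by linarith) haa
    refine ODE_solution_unique_of_mem_Ioo (v := fun _ => f)
      (s := fun _ => Metric.closedBall y₀ (M * a')) (fun _ _ => hK)
      (⟨by linarith, ha⟩ : (0 : ℝ) ∈ Ioo (-a) a)
      (fun t ht => ⟨hγ a t ht, Metric.closedBall_subset_closedBall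
        (mul_le_mul_of_nonneg_left haa hM0) (mem a t ht)⟩)
      (fun t ht => ⟨hγ a' t (hsub ht), mem a' t (hsub ht)⟩) ((h0 a).trans (h0 a').symm)
  -- The local curves agree where they overlap, so each time may use an interval of its own.
  refine ⟨fun t => γ (|t| + 1) t, h0 _, fun t => ?_⟩
  have ht : t ∈ Ioo (-(|t| + 1)) (|t| + 1) := abs_lt.1 (lt_add_one _)
  refine (hγ _ t ht).congr_of_eventuallyEq ?_
  filter_upwards [Ioo_mem_nhds ht.1 ht.2] with s hs
  have hs' : s ∈ Ioo (-(|s| + 1)) (|s| + 1) := abs_lt.1 (lt_add_one _)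
  rcases le_total (|s| + 1) (|t| + 1) with h | h
  · exact agree _ _ (by positivity) h hs'
  · exact (agree _ _ (by positivity) h hs).symm

/-- Gronwall's inequality in integral form. -/
theorem le_mul_exp_of_le_add_integral {z : ℝ → ℝ} (hz : Continuous z) (hz0 : ∀ s, 0 ≤ z s)
    {ε L T : ℝ} (hL : 0 < L) (hT : 0 ≤ T)
    (h : ∀ s ∈ Icc 0 T, z s ≤ ε + L * ∫ r in (0 : ℝ)..s, z r) :
    z T ≤ ε * Real.exp (L * T) := by
  have hd : ∀ s, HasDerivAt (fun s => ∫ r in (0 : ℝ)..s, z r) (z s) s := fun s =>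
    intervalIntegral.integral_hasDerivAt_right (hz.intervalIntegrable _ _)
      (hz.stronglyMeasurableAtFilter _ _) hz.continuousAt
  have hn : ∀ s, 0 ≤ s → 0 ≤ ∫ r in (0 : ℝ)..s, z r := fun s hs =>
    intervalIntegral.integral_nonneg hs fun r _ => hz0 r
  have := norm_le_gronwallBound_of_norm_deriv_right_le (f := fun s => ∫ r in (0 : ℝ)..s, z r)
    (f' := z) (δ := 0) (K := L) (ε := ε) (a := 0) (b := T)
    (fun s _ => (hd s).continuousAt.continuousWithinAt) (fun s _ => (hd s).hasDerivWithinAt)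
    (by simp) (fun s hs => by
      rw [Real.norm_of_nonneg (hz0 s), Real.norm_of_nonneg (hn s hs.1)]
      linarith [h s (Ico_subset_Icc_self hs)]) T ⟨hT, le_rfl⟩
  rw [Real.norm_of_nonneg (hn T hT), gronwallBound_of_K_ne_0 hL.ne'] at this
  have h2 := mul_le_mul_of_nonneg_left this hL.le
  have h3 : L * (0 * Real.exp (L * (T - 0)) + ε / L * (Real.exp (L * (T - 0)) - 1)) =
      ε * Real.exp (L * T) - ε := by
    field_simp; simp
  linarith [h T ⟨hT, le_rfl⟩]

/-! ### Conservation of speed along particle paths. -/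

namespace IsParticlePath

variable {B : E3 → E3} {ω : ℝ} {x₀ v₀ : E3} {X : ℝ → E3}

theorem hasDerivAt (hX : IsParticlePath B ω x₀ v₀ X) (t : ℝ) : HasDerivAt X (deriv X t) t :=
  (hX.differentiable t).hasDerivAt

theorem continuous (hX : IsParticlePath B ω x₀ v₀ X) : Continuous X :=
  hX.differentiable.continuous

theorem continuous_deriv (hX : IsParticlePath B ω x₀ v₀ X) : Continuous (deriv X) :=
  continuous_iff_continuousAt.2 fun t => (hX.equation t).continuousAt

/-- The magnetic force does no work. -/
theorem norm_deriv (hX : IsParticlePath B ω x₀ v₀ X) (t : ℝ) : ‖deriv X t‖ = ‖v₀‖ := by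
  have hd : ∀ s, HasDerivAt (fun s => ‖deriv X s‖ ^ 2) 0 s := fun s => by
    have := (hX.equation s).norm_sq
    rwa [inner_smul_right, inner_cross_self_left, mul_zero, mul_zero] at this
  have := is_const_of_deriv_eq_zero (fun s => (hd s).differentiableAt) (fun s => (hd s).deriv) t 0
  rw [hX.velocity_zero] at this
  exact (pow_left_inj₀ (norm_nonneg _) (norm_nonneg _) two_ne_zero).1 this

theorem norm_sub_le (hX : IsParticlePath B ω x₀ v₀ X) (s t : ℝ) :
    ‖X s - X t‖ ≤ ‖v₀‖ * |s - t| :=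
  convex_univ.norm_image_sub_le_of_norm_hasDerivWithin_le
    (fun r _ => (hX.hasDerivAt r).hasDerivWithinAt) (fun r _ => (hX.norm_deriv r).le)
    (mem_univ t) (mem_univ s)

end IsParticlePath

/-! ### Averaging over the gyration. -/

/-- The derivative of a `C¹` function of position and velocity in the direction of the magnetic
force integrates to `O((1 + t) / ω)` along particle paths. -/
theorem exists_norm_integral_fderiv_cross_le {G : Type*} [NormedAddCommGroup G] [NormedSpace ℝ G]
    [CompleteSpace G] {B : E3 → E3} (hB : Continuous B) {F : E3 × E3 → G} (hF : ContDiff ℝ 1 F)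
    {D : Set E3} (hD : IsCompact D) (v₀ : E3) :
    ∃ C, 0 ≤ C ∧ ∀ (ω : ℝ) (x₀ : E3) (X : ℝ → E3), 0 < ω → IsParticlePath B ω x₀ v₀ X →
      ∀ t, 0 ≤ t → (∀ s ∈ Icc 0 t, X s ∈ D) →
        ‖∫ s in (0 : ℝ)..t, fderiv ℝ F (X s, deriv X s) (0, cross (deriv X s) (B (X s)))‖
          ≤ C * (1 + t) / ω := by
  have hF' : Continuous (fderiv ℝ F) := hF.continuous_fderiv one_ne_zero
  have hS : IsCompact (D ×ˢ Metric.closedBall (0 : E3) ‖v₀‖) :=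
    hD.prod (isCompact_closedBall _ _)
  obtain ⟨C₁, hC₁⟩ := hS.exists_bound_of_continuousOn hF.continuous.continuousOn
  have hg : Continuous fun q : E3 × E3 => fderiv ℝ F q (q.2, 0) :=
    hF'.clm_apply (continuous_snd.prodMk continuous_const)
  obtain ⟨C₂, hC₂⟩ := hS.exists_bound_of_continuousOn hg.continuousOn
  refine ⟨2 * |C₁| + |C₂|, by positivity, fun ω x₀ X hω hX t ht hXD => ?_⟩
  have hmem : ∀ s ∈ Icc 0 t, (X s, deriv X s) ∈ D ×ˢ Metric.closedBall (0 : E3) ‖v₀‖ :=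
    fun s hs => ⟨hXD s hs, by simp [hX.norm_deriv s]⟩
  have hcont : Continuous fun s => (X s, deriv X s) := hX.continuous.prodMk hX.continuous_deriv
  have hc1 : Continuous fun s =>
      fderiv ℝ F (X s, deriv X s) (0, cross (deriv X s) (B (X s))) :=
    (hF'.comp hcont).clm_apply (continuous_const.prodMk
      (hX.continuous_deriv.cross (hB.comp hX.continuous)))
  have hc2 : Continuous fun s => fderiv ℝ F (X s, deriv X s) (deriv X s, 0) := hg.comp hcont
  have hc3 : Continuous fun s =>
      ω • fderiv ℝ F (X s, deriv X s) (0, cross (deriv X s) (B (X s))) := hc1.const_smul ω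
  -- Only the velocity derivative carries the factor `ω`; the increment of `F` and the integral of
  -- the other term are `O(1 + t)`.
  have hd : ∀ s, HasDerivAt (fun s => F (X s, deriv X s))
      (fderiv ℝ F (X s, deriv X s) (deriv X s, 0)
        + ω • fderiv ℝ F (X s, deriv X s) (0, cross (deriv X s) (B (X s)))) s := fun s => by
    have := ((hF.differentiable one_ne_zero) (X s, deriv X s)).hasFDerivAt.comp_hasDerivAt s
      ((hX.hasDerivAt s).prodMk (hX.equation s))
    have e : ((deriv X s, ω • cross (deriv X s) (B (X s))) : E3 × E3)
        = (deriv X s, 0) + ω • (0, cross (deriv X s) (B (X s))) := by simp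
    rwa [e, map_add, map_smul] at this
  have hint := intervalIntegral.integral_eq_sub_of_hasDerivAt (a := 0) (b := t)
    (fun s _ => hd s) ((hc2.add hc3).intervalIntegrable _ _)
  rw [intervalIntegral.integral_add (hc2.intervalIntegrable _ _)
    (hc3.intervalIntegrable _ _),
    intervalIntegral.integral_smul] at hint
  have h2 : ‖∫ s in (0 : ℝ)..t, fderiv ℝ F (X s, deriv X s) (deriv X s, 0)‖ ≤ |C₂| * t := by
    have := intervalIntegral.norm_integral_le_of_norm_le_const (a := 0) (b := t) (C := |C₂|)
      (f := fun s => fderiv ℝ F (X s, deriv X s) (deriv X s, 0)) (fun s hs => by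
        rw [uIoc_of_le ht] at hs
        exact (hC₂ _ (hmem s (Ioc_subset_Icc_self hs))).trans (le_abs_self _))
    simpa [abs_of_nonneg ht] using this
  have h1 : ∀ s ∈ Icc 0 t, ‖F (X s, deriv X s)‖ ≤ |C₁| := fun s hs =>
    (hC₁ _ (hmem s hs)).trans (le_abs_self _)
  rw [le_div_iff₀ hω, mul_comm _ ω]
  calc ω * ‖∫ s in (0 : ℝ)..t, fderiv ℝ F (X s, deriv X s) (0, cross (deriv X s) (B (X s)))‖
      = ‖ω • ∫ s in (0 : ℝ)..t,
          fderiv ℝ F (X s, deriv X s) (0, cross (deriv X s) (B (X s)))‖ := by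
        rw [norm_smul, Real.norm_of_nonneg hω.le]
    _ = ‖F (X t, deriv X t) - F (X 0, deriv X 0)
          - ∫ s in (0 : ℝ)..t, fderiv ℝ F (X s, deriv X s) (deriv X s, 0)‖ := by
        rw [← hint]; congr 1; abel
    _ ≤ |C₁| + |C₁| + |C₂| * t :=
        (norm_sub_le _ _).trans (add_le_add ((norm_sub_le _ _).trans
          (add_le_add (h1 t ⟨ht, le_rfl⟩) (h1 0 ⟨le_rfl, ht⟩))) h2)
    _ ≤ (2 * |C₁| + |C₂|) * (1 + t) := by
        nlinarith [abs_nonneg C₁, abs_nonneg C₂]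

/-- The derivative in the second variable of a map that is quadratic there. -/
theorem fderiv_snd_of_quadratic {G : Type*} [NormedAddCommGroup G] [NormedSpace ℝ G]
    {F : E3 × E3 → G} {y v w : E3} (hF : DifferentiableAt ℝ F (y, v)) {L M : G}
    (h : ∀ s : ℝ, F (y, v + s • w) = F (y, v) + s • L + s ^ 2 • M) :
    fderiv ℝ F (y, v) (0, w) = L := by
  have h1 : HasDerivAt (fun s : ℝ => (y, v + s • w)) (0, w) 0 := by
    have := (hasDerivAt_const (0 : ℝ) y).prodMk
      (((hasDerivAt_id (0 : ℝ)).smul_const w).const_add v)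
    simpa using this
  have hF' : DifferentiableAt ℝ F (y, v + (0 : ℝ) • w) := by simpa using hF
  have h2 := hF'.hasFDerivAt.comp_hasDerivAt (0 : ℝ) h1
  have h3 : HasDerivAt (fun s : ℝ => F (y, v) + s • L + s ^ 2 • M) L 0 := by
    have := (((hasDerivAt_id (0 : ℝ)).smul_const L).const_add (F (y, v))).add
      ((hasDerivAt_pow 2 (0 : ℝ)).smul_const M)
    simp only [one_smul, Nat.cast_ofNat, Nat.add_one_sub_one, pow_one, mul_zero, zero_smul,
      add_zero] at this
    exact this
  have h4 : (F ∘ fun s : ℝ => (y, v + s • w)) = fun s : ℝ => F (y, v) + s • L + s ^ 2 • M :=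
    funext h
  rw [h4] at h2
  simpa using h2.unique h3

/-- The trace of a linear operator on `E3` in the standard basis. -/
noncomputable def trace3 (A : E3 →L[ℝ] E3) : ℝ :=
  A (EuclideanSpace.single 0 1) 0 + A (EuclideanSpace.single 1 1) 1
    + A (EuclideanSpace.single 2 1) 2

/-- The mean of `⟪v, A v⟫` over all vectors of length `r` whose component along the unit vector
`b` is `u`. -/
noncomputable def gyroAverage (A : E3 →L[ℝ] E3) (b : E3) (r u : ℝ) : ℝ :=
  u ^ 2 * inner ℝ b (A b) + (r ^ 2 - u ^ 2) / 2 * (trace3 A - inner ℝ b (A b))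

/-- A rotation by a right angle about `b` turns the transversal part of a quadratic form into its
complement to twice the mean. -/
theorem inner_add_inner_rotated (A : E3 →L[ℝ] E3) {b v : E3} (hb : inner ℝ b b = (1 : ℝ)) :
    inner ℝ (v - inner ℝ b v • b) (A (v - inner ℝ b v • b)) + inner ℝ (cross b v) (A (cross b v))
      = (‖v‖ ^ 2 - inner ℝ b v ^ 2) * (trace3 A - inner ℝ b (A b)) := by
  rw [inner_eq_coord] at hb
  set W := v - inner ℝ b v • b with hW
  -- With `J = b × v`, the vectors `W` and `J` are orthogonal of equal length in the plane normal to
  -- `b`, so `W ⊗ W + J ⊗ J = |W|² (1 - b ⊗ b)`. Keeping the defect `|b|² - 1` as a factor makes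
  -- this a polynomial identity in free variables.
  have e : ∀ i j, W i * W j + cross b v i * cross b v j -
      (‖v‖ ^ 2 - inner ℝ b v ^ 2) * ((if i = j then 1 else 0) - b i * b j) =
      ((if i = j then 1 else 0) * ‖v‖ ^ 2 - v i * v j) *
        (b 0 * b 0 + b 1 * b 1 + b 2 * b 2 - 1) := by
    intro i j
    fin_cases i <;> fin_cases j <;>
    simp only [hW, Fin.zero_eta, Fin.mk_one, Fin.reduceFinMk, Fin.isValue, PiLp.sub_apply,
      PiLp.smul_apply, smul_eq_mul, cross_zero_apply, cross_one_apply, cross_two_apply,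
      norm_sq_eq_coord, inner_eq_coord, if_true, Fin.reduceEq, if_false] <;>
    ring
  simp only [hb, sub_self, mul_zero] at e
  have e' : ∀ i j, W i * W j + cross b v i * cross b v j =
      (‖v‖ ^ 2 - inner ℝ b v ^ 2) * ((if i = j then 1 else 0) - b i * b j) :=
    fun i j => sub_eq_zero.1 (e i j)
  have e00 := e' 0 0
  have e01 := e' 0 1
  have e02 := e' 0 2
  have e11 := e' 1 1
  have e12 := e' 1 2
  have e22 := e' 2 2
  simp only [if_true, Fin.reduceEq, if_false] at e00 e01 e02 e11 e12 e22
  generalize ‖v‖ ^ 2 - inner ℝ b v ^ 2 = q at *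
  generalize cross b v = J at *
  clear_value W
  simp only [trace3, inner_eq_coord, clm_apply_coord A W, clm_apply_coord A J,
    clm_apply_coord A b]
  generalize A (EuclideanSpace.single 0 1) = a₀
  generalize A (EuclideanSpace.single 1 1) = a₁
  generalize A (EuclideanSpace.single 2 1) = a₂
  linear_combination a₀ 0 * e00 + (a₀ 1 + a₁ 0) * e01 + (a₀ 2 + a₂ 0) * e02 + a₁ 1 * e11
    + (a₁ 2 + a₂ 1) * e12 + a₂ 2 * e22

section Averaging

variable {B : E3 → E3} {D : Set E3}

theorem inner_unitField_self {y : E3} (h : B y ≠ 0) :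
    inner ℝ (unitField B y) (unitField B y) = (1 : ℝ) := by
  have : ‖B y‖ ≠ 0 := norm_ne_zero_iff.2 h
  rw [unitField, real_inner_smul_left, real_inner_smul_right, real_inner_self_eq_norm_sq]
  field_simp

theorem norm_smul_unitField {y : E3} (h : B y ≠ 0) : ‖B y‖ • unitField B y = B y := by
  rw [unitField, smul_smul, mul_inv_cancel₀ (norm_ne_zero_iff.2 h), one_smul]

theorem norm_unitField {y : E3} (h : B y ≠ 0) : ‖unitField B y‖ = 1 := by
  rw [unitField, norm_smul, norm_inv, norm_norm, inv_mul_cancel₀ (norm_ne_zero_iff.2 h)]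

theorem contDiff_inv_norm {n : WithTop ℕ∞} (hB : ContDiff ℝ n B) (hB0 : ∀ y, B y ≠ 0) :
    ContDiff ℝ n fun y => ‖B y‖⁻¹ :=
  (hB.norm ℝ hB0).inv fun y => norm_ne_zero_iff.2 (hB0 y)

theorem contDiff_unitField {n : WithTop ℕ∞} (hB : ContDiff ℝ n B) (hB0 : ∀ y, B y ≠ 0) :
    ContDiff ℝ n (unitField B) :=
  (contDiff_inv_norm hB hB0).smul hB

/-- The velocity transversal to the magnetic field has mean zero. -/
theorem exists_norm_integral_transversal_le (hB : ContDiff ℝ 1 B) (hB0 : ∀ y, B y ≠ 0)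
    (hD : IsCompact D) (v₀ : E3) :
    ∃ C, 0 ≤ C ∧ ∀ (ω : ℝ) (x₀ : E3) (X : ℝ → E3), 0 < ω → IsParticlePath B ω x₀ v₀ X →
      ∀ t, 0 ≤ t → (∀ s ∈ Icc 0 t, X s ∈ D) →
        ‖∫ s in (0 : ℝ)..t, (deriv X s
          - inner ℝ (unitField B (X s)) (deriv X s) • unitField B (X s))‖ ≤ C * (1 + t) / ω := by
  -- The field turns the transversal velocity at angular rate `|B|`; a quarter turn divided by `|B|`
  -- is therefore a primitive.
  let F : E3 × E3 → E3 := fun q => ‖B q.1‖⁻¹ • cross (unitField B q.1) q.2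
  have hF : ContDiff ℝ 1 F :=
    ((contDiff_inv_norm hB hB0).comp contDiff_fst).smul
      (((contDiff_unitField hB hB0).comp contDiff_fst).cross contDiff_snd)
  have key : ∀ y v, fderiv ℝ F (y, v) (0, cross v (B y))
      = v - inner ℝ (unitField B y) v • unitField B y := fun y v => by
    refine fderiv_snd_of_quadratic (M := 0) (hF.differentiable one_ne_zero _) fun s => ?_
    have hn : ‖B y‖ ≠ 0 := norm_ne_zero_iff.2 (hB0 y)
    have h1 : cross (unitField B y) (cross v (B y))
        = ‖B y‖ • (v - inner ℝ (unitField B y) v • unitField B y) := by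
      conv_lhs => rw [← norm_smul_unitField (hB0 y)]
      rw [cross_smul_right, cross_smul_right, cross_cross_right, inner_unitField_self (hB0 y),
        one_smul]
    have h2 : cross (unitField B y) (v + s • cross v (B y)) = cross (unitField B y) v
        + s • cross (unitField B y) (cross v (B y)) := by
      simp only [← crossL_apply, map_add, map_smul]
    simp only [F]
    rw [h2, h1, smul_add, smul_zero, add_zero, smul_comm _ s, smul_smul _ ‖B y‖,
      inv_mul_cancel₀ hn, one_smul]
  obtain ⟨C, hC, h⟩ := exists_norm_integral_fderiv_cross_le hB.continuous hF hD v₀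
  refine ⟨C, hC, fun ω x₀ X hω hX t ht hXD => ?_⟩
  simpa only [key] using h ω x₀ X hω hX t ht hXD

/-- Along particle paths a quadratic form of the velocity is close to its mean over the
gyration. -/
theorem exists_abs_integral_sub_gyroAverage_le (hB : ContDiff ℝ 1 B) (hB0 : ∀ y, B y ≠ 0)
    {A : E3 → E3 →L[ℝ] E3} (hA : ContDiff ℝ 1 A) (hD : IsCompact D) (v₀ : E3) :
    ∃ C, 0 ≤ C ∧ ∀ (ω : ℝ) (x₀ : E3) (X : ℝ → E3), 0 < ω → IsParticlePath B ω x₀ v₀ X →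
      ∀ t, 0 ≤ t → (∀ s ∈ Icc 0 t, X s ∈ D) →
        ‖∫ s in (0 : ℝ)..t, (inner ℝ (deriv X s) (A (X s) (deriv X s))
          - gyroAverage (A (X s)) (unitField B (X s)) ‖v₀‖
              (inner ℝ (unitField B (X s)) (deriv X s)))‖ ≤ C * (1 + t) / ω := by
  have hb := contDiff_unitField hB hB0
  -- Split `v = u b + W` and put `J = b × v`. Under the gyration `W` moves by `-|B| J` and `J` by
  -- `|B| W`. The mixed terms are linear in `W`, with primitive obtained by putting `J` for `W`; the
  -- transversal term less its mean is `(W·AW - J·AJ)/2`, with primitive `W·AJ/2`. All are divided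
  -- by `|B|`.
  let F : E3 × E3 → ℝ := fun q => ‖B q.1‖⁻¹ *
    (inner ℝ (unitField B q.1) q.2 *
      (inner ℝ (unitField B q.1) (A q.1 (cross (unitField B q.1) q.2))
        + inner ℝ (cross (unitField B q.1) q.2) (A q.1 (unitField B q.1)))
    + 1 / 2 * inner ℝ (q.2 - inner ℝ (unitField B q.1) q.2 • unitField B q.1)
        (A q.1 (cross (unitField B q.1) q.2)))
  have hb1 : ContDiff ℝ 1 fun q : E3 × E3 => unitField B q.1 := hb.comp contDiff_fst
  have hA1 : ContDiff ℝ 1 fun q : E3 × E3 => A q.1 := hA.comp contDiff_fst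
  have hJ : ContDiff ℝ 1 fun q : E3 × E3 => cross (unitField B q.1) q.2 :=
    hb1.cross contDiff_snd
  have hu : ContDiff ℝ 1 fun q : E3 × E3 => (inner ℝ (unitField B q.1) q.2 : ℝ) :=
    hb1.inner ℝ contDiff_snd
  have hF : ContDiff ℝ 1 F :=
    ((contDiff_inv_norm hB hB0).comp contDiff_fst).mul
      ((hu.mul ((hb1.inner ℝ (hA1.clm_apply hJ)).add (hJ.inner ℝ (hA1.clm_apply hb1)))).add
        (contDiff_const.mul ((contDiff_snd.sub (hu.smul hb1)).inner ℝ (hA1.clm_apply hJ))))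
  have key : ∀ y v, fderiv ℝ F (y, v) (0, cross v (B y))
      = inner ℝ v (A y v) - gyroAverage (A y) (unitField B y) ‖v‖
          (inner ℝ (unitField B y) v) := fun y v => by
    have hn : ‖B y‖ ≠ 0 := norm_ne_zero_iff.2 (hB0 y)
    have h0 := inner_add_inner_rotated (A y) (v := v) (inner_unitField_self (hB0 y))
    have hw : cross v (B y) = -(‖B y‖ • cross (unitField B y) v) := by
      rw [cross_swap, ← cross_smul_left, norm_smul_unitField (hB0 y)]
    have hJw : cross (unitField B y) (cross v (B y))
        = ‖B y‖ • (v - inner ℝ (unitField B y) v • unitField B y) := by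
      conv_lhs => rw [← norm_smul_unitField (hB0 y)]
      rw [cross_smul_right, cross_smul_right, cross_cross_right, inner_unitField_self (hB0 y),
        one_smul]
    have huw : inner ℝ (unitField B y) (cross v (B y)) = (0 : ℝ) := by
      rw [hw, inner_neg_right, real_inner_smul_right, inner_cross_self_left]; simp
    have hv : v = inner ℝ (unitField B y) v • unitField B y
        + (v - inner ℝ (unitField B y) v • unitField B y) := by abel
    refine fderiv_snd_of_quadratic (M := ‖B y‖⁻¹ * (1 / 2 * inner ℝ (cross v (B y))
      (A y (cross (unitField B y) (cross v (B y)))))) (hF.differentiable one_ne_zero _)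
      fun s => ?_
    have hJs : cross (unitField B y) (v + s • cross v (B y)) = cross (unitField B y) v
        + (s * ‖B y‖) • (v - inner ℝ (unitField B y) v • unitField B y) := by
      rw [mul_smul, ← hJw]
      simp only [← crossL_apply, map_add, map_smul]
    have hus : inner ℝ (unitField B y) (v + s • cross v (B y))
        = inner ℝ (unitField B y) v := by
      rw [inner_add_right, real_inner_smul_right, huw]; ring
    have hWs : v + s • cross v (B y) - inner ℝ (unitField B y) v • unitField B y
        = (v - inner ℝ (unitField B y) v • unitField B y)
          - (s * ‖B y‖) • cross (unitField B y) v := by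
      rw [hw, smul_neg, smul_smul]; abel
    have hvA : inner ℝ v (A y v) = inner ℝ (unitField B y) v ^ 2 *
          inner ℝ (unitField B y) (A y (unitField B y))
        + inner ℝ (unitField B y) v * (inner ℝ (unitField B y)
            (A y (v - inner ℝ (unitField B y) v • unitField B y))
          + inner ℝ (v - inner ℝ (unitField B y) v • unitField B y) (A y (unitField B y)))
        + inner ℝ (v - inner ℝ (unitField B y) v • unitField B y)
            (A y (v - inner ℝ (unitField B y) v • unitField B y)) := by
      generalize v - inner ℝ (unitField B y) v • unitField B y = W at hv
      conv_lhs => rw [hv]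
      simp only [map_add, map_smul, inner_add_left, inner_add_right, real_inner_smul_left,
        real_inner_smul_right]
      ring
    simp only [F]
    rw [hus, hWs, hJs, hJw, hw, hvA, gyroAverage]
    generalize v - inner ℝ (unitField B y) v • unitField B y = W at *
    generalize cross (unitField B y) v = J at *
    simp only [map_add, map_smul, inner_add_left, inner_add_right, real_inner_smul_left,
      real_inner_smul_right, inner_sub_left, inner_neg_left, smul_eq_mul]
    field_simp
    linear_combination (-s * ‖B y‖) * h0
  obtain ⟨C, hC, h⟩ := exists_norm_integral_fderiv_cross_le hB.continuous hF hD v₀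
  refine ⟨C, hC, fun ω x₀ X hω hX t ht hXD => ?_⟩
  simpa only [key, hX.norm_deriv] using h ω x₀ X hω hX t ht hXD

end Averaging

/-! ### Derivatives of the fields and their gyration means. -/

section Fields

variable {B : E3 → E3}

theorem curl_zero_apply (B : E3 → E3) (y : E3) :
    curl B y 0 = fderiv ℝ B y (EuclideanSpace.single 1 1) 2
      - fderiv ℝ B y (EuclideanSpace.single 2 1) 1 := by simp [curl, partialDeriv]

theorem curl_one_apply (B : E3 → E3) (y : E3) :
    curl B y 1 = fderiv ℝ B y (EuclideanSpace.single 2 1) 0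
      - fderiv ℝ B y (EuclideanSpace.single 0 1) 2 := by simp [curl, partialDeriv]

theorem curl_two_apply (B : E3 → E3) (y : E3) :
    curl B y 2 = fderiv ℝ B y (EuclideanSpace.single 0 1) 1
      - fderiv ℝ B y (EuclideanSpace.single 1 1) 0 := by simp [curl, partialDeriv]

theorem divergence_eq_trace3 (B : E3 → E3) (y : E3) : divergence B y = trace3 (fderiv ℝ B y) := by
  simp [divergence, partialDeriv, trace3, Fin.sum_univ_three]

theorem contDiff_curl {n m : WithTop ℕ∞} (hB : ContDiff ℝ n B) (h : m + 1 ≤ n) :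
    ContDiff ℝ m (curl B) := by
  have hp : ∀ i j, ContDiff ℝ m (partialDeriv B i j) := fun i j =>
    contDiff_euclidean.1 ((hB.fderiv_right h).clm_apply contDiff_const) j
  refine contDiff_euclidean.2 fun i => ?_
  fin_cases i
  · exact (hp 1 2).sub (hp 2 1)
  · exact (hp 2 0).sub (hp 0 2)
  · exact (hp 0 1).sub (hp 1 0)

/-- The force `B × curl B`. -/
noncomputable def lorentzForce (B : E3 → E3) (y : E3) : E3 := cross (B y) (curl B y)

/-- The component of `curl B` perpendicular to `B`. -/
noncomputable def perpCurrent (B : E3 → E3) (y : E3) : E3 :=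
  ‖B y‖⁻¹ ^ 2 • cross (lorentzForce B y) (B y)

theorem contDiff_lorentzForce (hB : ContDiff ℝ 3 B) : ContDiff ℝ 2 (lorentzForce B) :=
  (hB.of_le (by norm_num)).cross (contDiff_curl hB (by norm_num))

theorem contDiff_perpCurrent (hB : ContDiff ℝ 3 B) (hB0 : ∀ y, B y ≠ 0) :
    ContDiff ℝ 2 (perpCurrent B) :=
  ((contDiff_inv_norm (hB.of_le (by norm_num)) hB0).pow 2).smul
    ((contDiff_lorentzForce hB).cross (hB.of_le (by norm_num)))

/-- As `P ⟂ B`, `(P × B)·(v × B) = |B|² P·v`. This makes `K·V` a primitive of the rate of change of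
pressure at order `ω`. -/
theorem inner_perpCurrent_cross (hB0 : ∀ y, B y ≠ 0) (y v : E3) :
    inner ℝ (perpCurrent B y) (cross v (B y)) = inner ℝ (lorentzForce B y) v := by
  have hn : ‖B y‖ ≠ 0 := norm_ne_zero_iff.2 (hB0 y)
  have h : inner ℝ (lorentzForce B y) (B y) = (0 : ℝ) := by
    rw [real_inner_comm]; exact inner_cross_self_left _ _
  rw [perpCurrent, real_inner_smul_left, inner_cross_cross, h, real_inner_self_eq_norm_sq]
  field_simp
  ring

theorem inner_perpCurrent (B : E3 → E3) (y v : E3) : inner ℝ (perpCurrent B y) v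
    = inner ℝ (cross (unitField B y) v) (lorentzForce B y) / ‖B y‖ := by
  rw [perpCurrent, unitField, cross_smul_left, real_inner_smul_left, real_inner_smul_left]
  have : inner ℝ (cross (lorentzForce B y) (B y)) v
      = inner ℝ (cross (B y) v) (lorentzForce B y) := by
    simp only [inner_eq_coord, cross_zero_apply, cross_one_apply, cross_two_apply]; ring
  rw [this]
  ring

theorem hasFDerivAt_norm_field {y : E3} (hB : DifferentiableAt ℝ B y) (hB0 : B y ≠ 0) :
    HasFDerivAt (fun z => ‖B z‖) (‖B y‖⁻¹ • (innerSL ℝ (B y)).comp (fderiv ℝ B y)) y := by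
  have hn : ‖B y‖ ≠ 0 := norm_ne_zero_iff.2 hB0
  have hd := (hB.norm ℝ hB0).hasFDerivAt
  have h1 := hd.mul hd
  have h2 := hB.hasFDerivAt.norm_sq
  have h3 : (fun z => ‖B z‖ ^ 2) = fun z => ‖B z‖ * ‖B z‖ := by ext; ring
  rw [h3] at h2
  have h4 := h1.unique h2
  have e : ‖B y‖⁻¹ • (innerSL ℝ (B y)).comp (fderiv ℝ B y) = fderiv ℝ (fun z => ‖B z‖) y := by
    rw [inv_smul_eq_iff₀ hn]
    have h5 := congrArg (fun l => (2⁻¹ : ℝ) • l) h4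
    simp only [← two_smul ℝ (‖B y‖ • fderiv ℝ (fun z => ‖B z‖) y), ← Nat.cast_smul_eq_nsmul ℝ,
      smul_smul] at h5
    norm_num at h5
    rw [show 1 / 2 * (2 * ‖B y‖) = ‖B y‖ by ring] at h5
    exact h5.symm
  rw [e]
  exact hd

theorem hasFDerivAt_inv_norm_field {y : E3} (hB : DifferentiableAt ℝ B y) (hB0 : B y ≠ 0) :
    HasFDerivAt (fun z => ‖B z‖⁻¹)
      (-(‖B y‖⁻¹ ^ 3) • (innerSL ℝ (B y)).comp (fderiv ℝ B y)) y := by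
  have hn : ‖B y‖ ≠ 0 := norm_ne_zero_iff.2 hB0
  have := (hasDerivAt_inv hn).comp_hasFDerivAt y (hasFDerivAt_norm_field hB hB0)
  have e : -(‖B y‖ ^ 2)⁻¹ • ‖B y‖⁻¹ • (innerSL ℝ (B y)).comp (fderiv ℝ B y)
      = -(‖B y‖⁻¹ ^ 3) • (innerSL ℝ (B y)).comp (fderiv ℝ B y) := by
    rw [smul_smul]
    congr 1
    field_simp
  rw [e] at this
  exact this

theorem fderiv_unitField_apply {y : E3} (hB : DifferentiableAt ℝ B y) (hB0 : B y ≠ 0) (w : E3) :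
    fderiv ℝ (unitField B) y w = ‖B y‖⁻¹ • fderiv ℝ B y w
      - (‖B y‖⁻¹ ^ 3 * inner ℝ (B y) (fderiv ℝ B y w)) • B y := by
  have := (hasFDerivAt_inv_norm_field hB hB0).smul hB.hasFDerivAt
  have h2 : unitField B = fun z => ‖B z‖⁻¹ • B z := rfl
  rw [h2]
  erw [this.fderiv]
  simp [sub_eq_add_neg]

theorem fderiv_perpCurrent_apply {y : E3} (hB : DifferentiableAt ℝ B y) (hB0 : B y ≠ 0)
    (hP : DifferentiableAt ℝ (lorentzForce B) y) (w : E3) :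
    fderiv ℝ (perpCurrent B) y w = ‖B y‖⁻¹ ^ 2 • (cross (lorentzForce B y) (fderiv ℝ B y w)
        + cross (fderiv ℝ (lorentzForce B) y w) (B y))
      - (2 * ‖B y‖⁻¹ ^ 4 * inner ℝ (B y) (fderiv ℝ B y w)) •
        cross (lorentzForce B y) (B y) := by
  have h1 := (hasFDerivAt_inv_norm_field hB hB0).pow 2
  have h2 := crossL.hasFDerivAt_of_bilinear hP.hasFDerivAt hB.hasFDerivAt
  have := h1.smul h2
  have h3 : perpCurrent B = fun z => ‖B z‖⁻¹ ^ 2 • crossL (lorentzForce B z) (B z) := rfl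
  rw [h3]
  erw [this.fderiv]
  simp [crossL_apply]
  module

theorem inner_unitField_fderiv {y : E3} (hB : DifferentiableAt ℝ B y) (hB0 : B y ≠ 0) (w : E3) :
    inner ℝ (unitField B y) (fderiv ℝ (unitField B) y w) = (0 : ℝ) := by
  have hn : ‖B y‖ ≠ 0 := norm_ne_zero_iff.2 hB0
  rw [fderiv_unitField_apply hB hB0, unitField, inner_sub_right]
  simp only [real_inner_smul_left, real_inner_smul_right, real_inner_self_eq_norm_sq]
  field_simp
  ring

/-- The mean force along the magnetic field on a particle of speed `r` at `q.1` with parallel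
velocity `q.2`. -/
noncomputable def mirrorForce (B : E3 → E3) (r : ℝ) (q : E3 × ℝ) : ℝ :=
  -((r ^ 2 - q.2 ^ 2) / 2 * (‖B q.1‖⁻¹ ^ 3 * inner ℝ (B q.1) (fderiv ℝ B q.1 (B q.1))))

/-- Since `|b| = 1`, the term `b·Db(b)` vanishes and only the trace remains; `div B = 0` reduces it
to the derivative of `|B|⁻¹` along `B`. -/
theorem gyroAverage_fderiv_unitField {y : E3} (hB : DifferentiableAt ℝ B y) (hB0 : B y ≠ 0)
    (hdiv : divergence B y = 0) (r u : ℝ) :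
    gyroAverage (fderiv ℝ (unitField B) y) (unitField B y) r u = mirrorForce B r (y, u) := by
  have ht : trace3 (fderiv ℝ (unitField B) y)
      = -(‖B y‖⁻¹ ^ 3 * inner ℝ (B y) (fderiv ℝ B y (B y))) := by
    rw [divergence_eq_trace3] at hdiv
    simp only [trace3, fderiv_unitField_apply hB hB0, PiLp.sub_apply, PiLp.smul_apply,
      smul_eq_mul, inner_eq_coord, clm_apply_coord (fderiv ℝ B y) (B y)] at hdiv ⊢
    linear_combination ‖B y‖⁻¹ * hdiv
  rw [gyroAverage, inner_unitField_fderiv hB hB0, ht, mirrorForce]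
  ring

theorem gradient_inv_norm_field {y : E3} (hB : DifferentiableAt ℝ B y) (hB0 : B y ≠ 0) (w : E3) :
    inner ℝ w (gradient (fun z => ‖B z‖⁻¹) y)
      = -(‖B y‖⁻¹ ^ 3 * inner ℝ (B y) (fderiv ℝ B y w)) := by
  rw [gradient, real_inner_comm, InnerProductSpace.toDual_symm_apply,
    (hasFDerivAt_inv_norm_field hB hB0).fderiv]
  simp

/-- In a plasma equilibrium the mean of the quadratic form `D(perpCurrent B)` is the drift
density. -/
theorem gyroAverage_fderiv_perpCurrent {y : E3} (hB : DifferentiableAt ℝ B y) (hB0 : B y ≠ 0)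
    (hP : DifferentiableAt ℝ (lorentzForce B) y)
    (hsymm : ∀ v w, inner ℝ (fderiv ℝ (lorentzForce B) y v) w
      = inner ℝ (fderiv ℝ (lorentzForce B) y w) v) (r u : ℝ) :
    gyroAverage (fderiv ℝ (perpCurrent B) y) (unitField B y) r u
      = -((r ^ 2 / ‖B y‖ - (r ^ 2 - u ^ 2) / (2 * ‖B y‖)) *
          inner ℝ (cross (B y) (lorentzForce B y)) (gradient (fun z => ‖B z‖⁻¹) y)) := by
  have hn : ‖B y‖ ≠ 0 := norm_ne_zero_iff.2 hB0
  have hs01 := hsymm (EuclideanSpace.single 0 1) (EuclideanSpace.single 1 1)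
  have hs02 := hsymm (EuclideanSpace.single 0 1) (EuclideanSpace.single 2 1)
  have hs12 := hsymm (EuclideanSpace.single 1 1) (EuclideanSpace.single 2 1)
  simp only [inner_eq_coord] at hs01 hs02 hs12
  simp at hs01 hs02 hs12
  -- Direct differentiation gives `w·DB(B)` with `w = B × P`. Exchanging `w` and `B` costs `B·(curl
  -- B × w) = w·P = 0`.
  have ha : inner ℝ (B y) (fderiv ℝ (perpCurrent B) y (B y))
      = ‖B y‖⁻¹ ^ 2 * inner ℝ (B y)
          (fderiv ℝ B y (cross (B y) (lorentzForce B y))) := by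
    rw [fderiv_perpCurrent_apply hB hB0 hP, inner_sub_right, real_inner_smul_right,
      real_inner_smul_right, inner_add_right, inner_cross_self_right, inner_cross_self_right]
    have hc := clm_apply_coord (fderiv ℝ B y) (cross (B y) (lorentzForce B y))
    have hc' := clm_apply_coord (fderiv ℝ B y) (B y)
    simp only [inner_eq_coord, hc]
    simp only [hc', cross_zero_apply,
      cross_one_apply, cross_two_apply, lorentzForce, curl_zero_apply, curl_one_apply,
      curl_two_apply]
    ring
  -- `div (P × B) = B·curl P - P·curl B`. The first term vanishes by the symmetry of `DP`, the
  -- second since `P = B × curl B`; only the derivative of `|B|⁻²` survives. The trace is thus twice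
  -- `b·DK(b)`, so both parts of the mean carry the same factor.
  have ht : trace3 (fderiv ℝ (perpCurrent B) y)
      = 2 * ‖B y‖⁻¹ ^ 4 * inner ℝ (B y)
          (fderiv ℝ B y (cross (B y) (lorentzForce B y))) := by
    have hc := clm_apply_coord (fderiv ℝ B y) (cross (B y) (lorentzForce B y))
    simp only [trace3, fderiv_perpCurrent_apply hB hB0 hP, PiLp.sub_apply, PiLp.smul_apply,
      PiLp.add_apply, smul_eq_mul, inner_eq_coord, hc, cross_zero_apply, cross_one_apply,
      cross_two_apply]
    have hJ : lorentzForce B y 0 * curl B y 0 + lorentzForce B y 1 * curl B y 1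
        + lorentzForce B y 2 * curl B y 2 = 0 := by
      rw [← inner_eq_coord, real_inner_comm]; exact inner_cross_self_right _ _
    rw [curl_zero_apply, curl_one_apply, curl_two_apply] at hJ
    linear_combination ‖B y‖⁻¹ ^ 2 * (-hJ + B y 2 * hs01 - B y 1 * hs02 + B y 0 * hs12)
  rw [gyroAverage, ht, gradient_inv_norm_field hB hB0]
  have hb : inner ℝ (unitField B y) (fderiv ℝ (perpCurrent B) y (unitField B y))
      = ‖B y‖⁻¹ ^ 4 * inner ℝ (B y)
          (fderiv ℝ B y (cross (B y) (lorentzForce B y))) := by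
    rw [unitField, map_smul, real_inner_smul_left, real_inner_smul_right, ha]
    ring
  rw [hb]
  field_simp
  ring

end Fields

/-! ### Particle paths and guiding centres. -/

/-- A `C¹` vector field on `E3 × W` that is bounded as long as the second component is, and has a
first integral controlling the second component, is complete. -/
theorem exists_integral_curve_of_invariant {W : Type*} [NormedAddCommGroup W]
    [InnerProductSpace ℝ W] [FiniteDimensional ℝ W] {f : E3 × W → E3 × W} (hf : ContDiff ℝ 1 f)
    (hbd : ∀ R : ℝ, ∃ M : ℝ, ∀ q : E3 × W, ‖q.2‖ ≤ R → ‖f q‖ ≤ M) {I : E3 × W → ℝ}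
    {I' : E3 × W → E3 × W →L[ℝ] ℝ} (hI : ∀ q, HasFDerivAt I (I' q) q) (hIf : ∀ q, I' q (f q) = 0)
    (hI2 : ∀ q, ‖q.2‖ ^ 2 ≤ I q) (q₀ : E3 × W) :
    ∃ γ : ℝ → E3 × W, γ 0 = q₀ ∧ (∀ t, HasDerivAt γ (f (γ t)) t) ∧ ∀ t, I (γ t) = I q₀ := by
  have hI0 : 0 ≤ I q₀ := (sq_nonneg _).trans (hI2 q₀)
  -- Cutting off preserves the first integral, and `r² ≤ I` implies `r ≤ I + 1`, so the curve never
  -- leaves the region where the cutoff is `1`.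
  let φ : ContDiffBump (0 : W) := ⟨I q₀ + 1, I q₀ + 2, by linarith, by linarith⟩
  obtain ⟨M, hM⟩ := hbd (I q₀ + 2)
  have hg : ContDiff ℝ 1 fun q : E3 × W => φ q.2 • f q :=
    (φ.contDiff.comp contDiff_snd).smul hf
  have hgM : ∀ q : E3 × W, ‖φ q.2 • f q‖ ≤ |M| := fun q => by
    rw [norm_smul, Real.norm_of_nonneg φ.nonneg]
    by_cases h : ‖q.2‖ ≤ I q₀ + 2
    · exact (mul_le_of_le_one_left (norm_nonneg _) φ.le_one).trans
        ((hM q h).trans (le_abs_self M))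
    · rw [φ.zero_of_le_dist (by rw [dist_zero_right]; exact (not_le.1 h).le), zero_mul]
      exact abs_nonneg M
  obtain ⟨γ, h0, hγ⟩ := exists_integral_curve_of_bounded hg hgM q₀
  have hd : ∀ t, HasDerivAt (fun t => I (γ t)) 0 t := fun t => by
    have := (hI (γ t)).comp_hasDerivAt t (hγ t)
    rwa [map_smul, hIf, smul_zero] at this
  have hc : ∀ t, I (γ t) = I q₀ := fun t => by
    rw [← h0]
    exact is_const_of_deriv_eq_zero (fun s => (hd s).differentiableAt) (fun s => (hd s).deriv) t 0
  refine ⟨γ, h0, fun t => ?_, hc⟩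
  have h1 : φ (γ t).2 = 1 := φ.one_of_mem_closedBall (by
    rw [mem_closedBall_zero_iff]
    change ‖(γ t).2‖ ≤ I q₀ + 1
    nlinarith [hI2 (γ t), hc t, sq_nonneg (‖(γ t).2‖ - 1)])
  have := hγ t
  rwa [h1, one_smul] at this

section Paths

variable {B : E3 → E3}

theorem norm_cross_le (u v : E3) : ‖cross u v‖ ≤ ‖crossL‖ * ‖u‖ * ‖v‖ :=
  crossL.le_opNorm₂ u v

/-- The squared speed is the first integral that prevents blow-up. -/
theorem exists_particlePath (hB : ContDiff ℝ 1 B) {M : ℝ} (hM : ∀ y, ‖B y‖ ≤ M) (ω : ℝ)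
    (x₀ v₀ : E3) : ∃ X, IsParticlePath B ω x₀ v₀ X := by
  have hf : ContDiff ℝ 1 fun q : E3 × E3 => (q.2, ω • cross q.2 (B q.1)) :=
    contDiff_snd.prodMk ((contDiff_snd.cross (hB.comp contDiff_fst)).const_smul ω)
  obtain ⟨γ, h0, hγ, -⟩ := exists_integral_curve_of_invariant hf
    (fun R => ⟨max R (|ω| * (‖crossL‖ * R * M)), fun q hq => by
      rw [Prod.norm_def]
      refine max_le_max hq ?_
      rw [norm_smul, Real.norm_eq_abs]
      gcongr
      have hR : 0 ≤ R := (norm_nonneg _).trans hq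
      exact (norm_cross_le _ _).trans (by gcongr; exact hM _)⟩)
    (I := fun q => ‖q.2‖ ^ 2) (fun q => (hasFDerivAt_snd (p := q)).norm_sq)
    (fun q => by simp [inner_cross_self_left]) (fun q => le_rfl) (x₀, v₀)
  have h1 : ∀ t, HasDerivAt (fun t => (γ t).1) (γ t).2 t := fun t => (hγ t).fst
  have h2 : ∀ t, HasDerivAt (fun t => (γ t).2) (ω • cross (γ t).2 (B (γ t).1)) t :=
    fun t => (hγ t).snd
  have hd : deriv (fun t => (γ t).1) = fun t => (γ t).2 := funext fun t => (h1 t).deriv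
  exact ⟨fun t => (γ t).1, fun t => (h1 t).differentiableAt, fun t => by rw [hd]; exact h2 t,
    by simp [h0], by rw [hd]; simp [h0]⟩

theorem IsParticlePath.unique (hB : ContDiff ℝ 1 B) {ω : ℝ} {x₀ v₀ : E3} {X Y : ℝ → E3}
    (hX : IsParticlePath B ω x₀ v₀ X) (hY : IsParticlePath B ω x₀ v₀ Y) : X = Y := by
  ext1 t
  have hf : ContDiff ℝ 1 fun q : E3 × E3 => (q.2, ω • cross q.2 (B q.1)) :=
    contDiff_snd.prodMk ((contDiff_snd.cross (hB.comp contDiff_fst)).const_smul ω)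
  obtain ⟨K, hK⟩ := hf.exists_lipschitzOnWith_of_isCompact
    ((isCompact_closedBall x₀ (‖v₀‖ * (|t| + 1))).prod (isCompact_closedBall (0 : E3) ‖v₀‖))
  have mem : ∀ {Z : ℝ → E3}, IsParticlePath B ω x₀ v₀ Z → ∀ s ∈ Ioo (-(|t| + 1)) (|t| + 1),
      HasDerivAt (fun s => (Z s, deriv Z s)) (deriv Z s, ω • cross (deriv Z s) (B (Z s))) s ∧
      (Z s, deriv Z s) ∈ Metric.closedBall x₀ (‖v₀‖ * (|t| + 1)) ×ˢ
        Metric.closedBall (0 : E3) ‖v₀‖ := fun {Z} hZ s hs => by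
    refine ⟨(hZ.hasDerivAt s).prodMk (hZ.equation s), ?_, by simp [hZ.norm_deriv]⟩
    have := hZ.norm_sub_le s 0
    rw [hZ.position_zero, sub_zero] at this
    rw [mem_closedBall_iff_norm]
    exact this.trans (mul_le_mul_of_nonneg_left (abs_lt.2 hs).le (norm_nonneg _))
  have hu := ODE_solution_unique_of_mem_Ioo
    (v := fun _ q => (q.2, ω • cross q.2 (B q.1)))
    (s := fun _ => Metric.closedBall x₀ (‖v₀‖ * (|t| + 1)) ×ˢ Metric.closedBall (0 : E3) ‖v₀‖)
    (fun _ _ => hK) (⟨by linarith [abs_nonneg t], by positivity⟩ :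
      (0 : ℝ) ∈ Ioo (-(|t| + 1)) (|t| + 1)) (mem hX) (mem hY)
    (by simp [hX.position_zero, hY.position_zero, hX.velocity_zero, hY.velocity_zero])
  exact congrArg Prod.fst (hu (abs_lt.1 (lt_add_one |t|)))

/-- The guiding centre `x` and the parallel velocity `h` of a particle in the limit of a strong
magnetic field. -/
structure IsGuidingCenter (B : E3 → E3) (x₀ v₀ : E3) (x : ℝ → E3) (h : ℝ → ℝ) : Prop where
  position_zero : x 0 = x₀
  velocity_zero : h 0 = inner ℝ (unitField B x₀) v₀
  hasDerivAt_position : ∀ t, HasDerivAt x (h t • unitField B (x t)) t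
  hasDerivAt_velocity : ∀ t, HasDerivAt h (mirrorForce B ‖v₀‖ (x t, h t)) t
  abs_velocity_le : ∀ t, |h t| ≤ ‖v₀‖
  moment_eq : ∀ t, magneticMoment B v₀ x h t = magneticMoment B v₀ x h 0

theorem contDiff_inner_fderiv (hB : ContDiff ℝ 2 B) :
    ContDiff ℝ 1 fun y => (inner ℝ (B y) (fderiv ℝ B y (B y)) : ℝ) :=
  (hB.of_le one_le_two).inner ℝ
    ((hB.fderiv_right (by norm_num)).clm_apply (hB.of_le one_le_two))

theorem contDiff_mirrorForce (hB : ContDiff ℝ 2 B) (hB0 : ∀ y, B y ≠ 0) (r : ℝ) :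
    ContDiff ℝ 1 (mirrorForce B r) :=
  ((((contDiff_const.sub (contDiff_snd.pow 2)).div_const 2).mul
    ((((contDiff_inv_norm (hB.of_le one_le_two) hB0).pow 3).mul
      (contDiff_inner_fderiv hB)).comp contDiff_fst))).neg

/-- The moment `μ` is frozen at its initial value and `h' = -μ b·∇|B|` is solved. This system
conserves `h² + 2μ|B|`; the conservation law says that the moment stays `μ`, which turns the
equation back into the one with `mirrorForce`. -/
theorem exists_isGuidingCenter (hB : ContDiff ℝ 2 B) (hB0 : ∀ y, B y ≠ 0) {M : ℝ}
    (hM : ∀ y, ‖fderiv ℝ B y‖ ≤ M) (x₀ v₀ : E3) : ∃ x h, IsGuidingCenter B x₀ v₀ x h := by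
  have hn : ∀ y, 0 < ‖B y‖ := fun y => norm_pos_iff.2 (hB0 y)
  have hB1 : ContDiff ℝ 1 B := hB.of_le one_le_two
  set h₀ : ℝ := inner ℝ (unitField B x₀) v₀ with hh₀
  set μ : ℝ := (‖v₀‖ ^ 2 - h₀ ^ 2) / (2 * ‖B x₀‖) with hμ
  have hh₀v : h₀ ^ 2 ≤ ‖v₀‖ ^ 2 := by
    have := abs_real_inner_le_norm (unitField B x₀) v₀
    rw [norm_unitField (hB0 x₀), one_mul] at this
    exact sq_le_sq' (by linarith [neg_abs_le h₀]) (by linarith [le_abs_self h₀])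
  have hμ0 : 0 ≤ μ := div_nonneg (by linarith) (by linarith [hn x₀])
  let g : E3 → ℝ := fun y => ‖B y‖⁻¹ ^ 2 * inner ℝ (B y) (fderiv ℝ B y (B y))
  have hf : ContDiff ℝ 1 fun q : E3 × ℝ => (q.2 • unitField B q.1, -μ * g q.1) :=
    (contDiff_snd.smul ((contDiff_unitField hB1 hB0).comp contDiff_fst)).prodMk
      (contDiff_const.mul ((((contDiff_inv_norm hB1 hB0).pow 2).mul
        (contDiff_inner_fderiv hB)).comp contDiff_fst))
  have hgM : ∀ y, |g y| ≤ M := fun y => by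
    have h1 : |(inner ℝ (B y) (fderiv ℝ B y (B y)) : ℝ)| ≤ ‖B y‖ ^ 2 * M := by
      refine (abs_real_inner_le_norm _ _).trans ?_
      have := (fderiv ℝ B y).le_of_opNorm_le (hM y) (B y)
      nlinarith [hn y]
    have : 0 < ‖B y‖ ^ 2 := pow_pos (hn y) 2
    simp only [g]
    rw [inv_pow, abs_mul, abs_of_pos (inv_pos.2 this), inv_mul_le_iff₀ this]
    exact h1
  have hI : ∀ q : E3 × ℝ, HasFDerivAt (fun q : E3 × ℝ => q.2 ^ 2 + 2 * μ * ‖B q.1‖) _ q :=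
    fun q => ((hasFDerivAt_snd (p := q)).pow 2).add
      (((hasFDerivAt_norm_field (hB1.differentiable one_ne_zero q.1) (hB0 q.1)).comp q
        hasFDerivAt_fst).const_mul (2 * μ))
  obtain ⟨γ, h0, hγ, hc⟩ := exists_integral_curve_of_invariant hf
    (fun R => ⟨max R (μ * M), fun q hq => by
      rw [Prod.norm_def]
      refine max_le_max ?_ ?_
      · rw [norm_smul, norm_unitField (hB0 _), mul_one]; exact hq
      · rw [norm_mul, norm_neg, Real.norm_of_nonneg hμ0]
        exact mul_le_mul_of_nonneg_left (hgM _) hμ0⟩) hI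
    (fun q => by
      simp [unitField, g]
      ring)
    (fun q => by
      rw [Real.norm_eq_abs, sq_abs]
      have := mul_nonneg hμ0 (hn q.1).le
      linarith) (x₀, h₀)
  have h1 : ∀ t, HasDerivAt (fun t => (γ t).1) ((γ t).2 • unitField B (γ t).1) t :=
    fun t => (hγ t).fst
  have h2 : ∀ t, HasDerivAt (fun t => (γ t).2) (-μ * g (γ t).1) t := fun t => (hγ t).snd
  have hE : ∀ t, (γ t).2 ^ 2 + 2 * μ * ‖B (γ t).1‖ = ‖v₀‖ ^ 2 := fun t => by
    rw [hc t, hμ]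
    have := (hn x₀).ne'
    field_simp
    ring
  have hm : ∀ t, magneticMoment B v₀ (fun t => (γ t).1) (fun t => (γ t).2) t = μ := fun t => by
    rw [magneticMoment, ← hE t]
    have := (hn (γ t).1).ne'
    field_simp
    ring
  refine ⟨fun t => (γ t).1, fun t => (γ t).2, by simp [h0], by simp [h0, hh₀], h1, fun t => ?_,
    fun t => ?_, fun t => (hm t).trans (hm 0).symm⟩
  · convert h2 t using 1
    rw [mirrorForce, ← hE t]
    have := (hn (γ t).1).ne'
    simp only [g]
    field_simp
    ring
  · refine abs_le_of_sq_le_sq ?_ (norm_nonneg _)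
    have := mul_nonneg hμ0 (hn (γ t).1).le
    linarith [hE t]

end Paths

/-- The oscillating part `a` is small only after integration, while `b` is bounded pointwise by the
quantity that enters Gronwall. -/
theorem norm_le_add_integral_of_hasDerivAt {G : Type*} [NormedAddCommGroup G] [NormedSpace ℝ G]
    [CompleteSpace G] {f a b : ℝ → G} {z : ℝ → ℝ} {t ε L : ℝ} (ht : 0 ≤ t) (ha : Continuous a)
    (hb : Continuous b) (hz : Continuous z) (hf : ∀ s, HasDerivAt f (a s + b s) s) (h0 : f 0 = 0)
    (hε : ‖∫ s in (0 : ℝ)..t, a s‖ ≤ ε) (hL : ∀ s ∈ Icc 0 t, ‖b s‖ ≤ L * z s) :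
    ‖f t‖ ≤ ε + L * ∫ s in (0 : ℝ)..t, z s := by
  have h1 := intervalIntegral.integral_eq_sub_of_hasDerivAt (a := 0) (b := t) (fun s _ => hf s)
    ((ha.add hb).intervalIntegrable _ _)
  rw [h0, sub_zero, intervalIntegral.integral_add (ha.intervalIntegrable _ _)
    (hb.intervalIntegrable _ _)] at h1
  rw [← h1, ← intervalIntegral.integral_const_mul]
  refine (norm_add_le _ _).trans (add_le_add hε ?_)
  exact intervalIntegral.norm_integral_le_of_norm_le ht
    (Eventually.of_forall fun s hs => hL s (Ioc_subset_Icc_self hs))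
    ((continuous_const.mul hz).intervalIntegrable _ _)

/-! ### Convergence to the guiding centre. -/

section Comparison

variable {B : E3 → E3} {ω : ℝ} {x₀ v₀ : E3} {X x : ℝ → E3} {h : ℝ → ℝ}

theorem inner_unitField_cross (B : E3 → E3) (y v : E3) :
    inner ℝ (unitField B y) (cross v (B y)) = (0 : ℝ) := by
  rw [unitField, real_inner_smul_left, inner_cross_self_right, mul_zero]

namespace IsParticlePath

/-- The force is orthogonal to `b`, so the term of order `ω` drops out. -/
theorem hasDerivAt_parallel (hX : IsParticlePath B ω x₀ v₀ X)
    (hb : Differentiable ℝ (unitField B)) (s : ℝ) :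
    HasDerivAt (fun s => (inner ℝ (unitField B (X s)) (deriv X s) : ℝ))
      (inner ℝ (deriv X s) (fderiv ℝ (unitField B) (X s) (deriv X s))) s := by
  have h1 := (hb (X s)).hasFDerivAt.comp_hasDerivAt s (hX.hasDerivAt s)
  have h2 := h1.inner ℝ (hX.equation s)
  simp only [Function.comp_apply] at h2
  rw [real_inner_smul_right, inner_unitField_cross, mul_zero, zero_add, real_inner_comm] at h2
  exact h2

theorem abs_parallel_le (hX : IsParticlePath B ω x₀ v₀ X) (hB0 : ∀ y, B y ≠ 0) (s : ℝ) :
    |(inner ℝ (unitField B (X s)) (deriv X s) : ℝ)| ≤ ‖v₀‖ := by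
  have := abs_real_inner_le_norm (unitField B (X s)) (deriv X s)
  rwa [norm_unitField (hB0 _), one_mul, hX.norm_deriv] at this

end IsParticlePath

namespace IsGuidingCenter

theorem continuous (hx : IsGuidingCenter B x₀ v₀ x h) : Continuous x :=
  continuous_iff_continuousAt.2 fun t => (hx.hasDerivAt_position t).continuousAt

theorem continuous_velocity (hx : IsGuidingCenter B x₀ v₀ x h) : Continuous h :=
  continuous_iff_continuousAt.2 fun t => (hx.hasDerivAt_velocity t).continuousAt

theorem norm_sub_le (hx : IsGuidingCenter B x₀ v₀ x h) (hB0 : ∀ y, B y ≠ 0) (s t : ℝ) :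
    ‖x s - x t‖ ≤ ‖v₀‖ * |s - t| :=
  convex_univ.norm_image_sub_le_of_norm_hasDerivWithin_le
    (fun r _ => (hx.hasDerivAt_position r).hasDerivWithinAt) (fun r _ => by
      rw [norm_smul, norm_unitField (hB0 _), mul_one]; exact hx.abs_velocity_le r)
    (mem_univ t) (mem_univ s)

/-- As long as the particle and its guiding centre stay in a compact set, their distance and the
difference of their parallel velocities are of order `1 / ω`. -/
theorem exists_norm_sub_le (hx : IsGuidingCenter B x₀ v₀ x h) (hB : ContDiff ℝ 3 B)
    (hB0 : ∀ y, B y ≠ 0) (hdiv : ∀ y, divergence B y = 0) {D : Set E3} (hD : IsCompact D) :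
    ∃ C, 0 ≤ C ∧ ∀ (ω : ℝ) (X : ℝ → E3), 0 < ω → IsParticlePath B ω x₀ v₀ X →
      ∀ t, 0 ≤ t → (∀ s ∈ Icc 0 t, X s ∈ D) → (∀ s ∈ Icc 0 t, x s ∈ D) →
        ‖(X t, (inner ℝ (unitField B (X t)) (deriv X t) : ℝ)) - (x t, h t)‖
          ≤ C / ω * Real.exp (C * t) := by
  have hB1 : ContDiff ℝ 1 B := hB.of_le (by norm_num)
  have hB2 : ContDiff ℝ 2 B := hB.of_le (by norm_num)
  have hb2 : ContDiff ℝ 2 (unitField B) := contDiff_unitField hB2 hB0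
  have hb1 : ContDiff ℝ 1 (unitField B) := hb2.of_le one_le_two
  have hmf := contDiff_mirrorForce hB2 hB0 ‖v₀‖
  have hΦ : ContDiff ℝ 1 fun q : E3 × ℝ => (q.2 • unitField B q.1, mirrorForce B ‖v₀‖ q) :=
    (contDiff_snd.smul (hb1.comp contDiff_fst)).prodMk hmf
  obtain ⟨K, hK⟩ := hΦ.exists_lipschitzOnWith_of_isCompact
    (hD.prod (isCompact_closedBall (0 : ℝ) ‖v₀‖))
  obtain ⟨C₁, hC₁, h₁⟩ := exists_norm_integral_transversal_le hB1 hB0 hD v₀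
  have hDb : ContDiff ℝ 1 (fderiv ℝ (unitField B)) := hb2.fderiv_right (by norm_num)
  obtain ⟨C₂, hC₂, h₂⟩ := exists_abs_integral_sub_gyroAverage_le hB1 hB0 hDb hD v₀
  have hL : (0 : ℝ) < K + 1 := by positivity
  refine ⟨C₁ + C₂ + K + 2, by positivity, fun ω X hω hX t ht hXD hxD => ?_⟩
  set u : ℝ → ℝ := fun s => inner ℝ (unitField B (X s)) (deriv X s) with hu
  have huc : Continuous u := continuous_iff_continuousAt.2 fun s =>
    (hX.hasDerivAt_parallel (hb1.differentiable one_ne_zero) s).continuousAt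
  have hz : Continuous fun s => ‖(X s, u s) - (x s, h s)‖ :=
    ((hX.continuous.prodMk huc).sub (hx.continuous.prodMk hx.continuous_velocity)).norm
  have hlip : ∀ s ∈ Icc 0 t,
      ‖(u s • unitField B (X s), mirrorForce B ‖v₀‖ (X s, u s))
        - (h s • unitField B (x s), mirrorForce B ‖v₀‖ (x s, h s))‖
      ≤ (K + 1) * ‖(X s, u s) - (x s, h s)‖ := fun s hs => by
    have := hK.norm_sub_le (x := (X s, u s)) (y := (x s, h s))
      ⟨hXD s hs, by simpa using hX.abs_parallel_le hB0 s⟩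
      ⟨hxD s hs, by simpa using hx.abs_velocity_le s⟩
    refine this.trans ?_
    gcongr
    linarith
  have hbX : Continuous fun s => unitField B (X s) := hb1.continuous.comp hX.continuous
  have hbx : Continuous fun s => unitField B (x s) := hb1.continuous.comp hx.continuous
  have hmX : Continuous fun s => mirrorForce B ‖v₀‖ (X s, u s) :=
    hmf.continuous.comp (hX.continuous.prodMk huc)
  have hmx : Continuous fun s => mirrorForce B ‖v₀‖ (x s, h s) :=
    hmf.continuous.comp (hx.continuous.prodMk hx.continuous_velocity)
  have hVA : Continuous fun s =>
      (inner ℝ (deriv X s) (fderiv ℝ (unitField B) (X s) (deriv X s)) : ℝ) :=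
    hX.continuous_deriv.inner ((hDb.continuous.comp hX.continuous).clm_apply hX.continuous_deriv)
  have hga : ∀ s, gyroAverage (fderiv ℝ (unitField B) (X s)) (unitField B (X s)) ‖v₀‖ (u s)
      = mirrorForce B ‖v₀‖ (X s, u s) := fun s =>
    gyroAverage_fderiv_unitField (hB1.differentiable one_ne_zero _) (hB0 _) (hdiv _) _ _
  have key : ∀ s ∈ Icc 0 t, ‖(X s, u s) - (x s, h s)‖ ≤ (C₁ + C₂) * (1 + t) / ω
      + (K + 1) * ∫ r in (0 : ℝ)..s, ‖(X r, u r) - (x r, h r)‖ := fun s hs => by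
    have hsub : ∀ r ∈ Icc 0 s, r ∈ Icc 0 t := fun r hr => ⟨hr.1, hr.2.trans hs.2⟩
    have hle : ∀ C', 0 ≤ C' → C' ≤ C₁ + C₂ →
        C' * (1 + s) / ω ≤ (C₁ + C₂) * (1 + t) / ω := fun C' h0 hC' => by
      have := hs.1
      gcongr
      exact hs.2
    rw [Prod.norm_def]
    refine max_le ?_ ?_
    · refine norm_le_add_integral_of_hasDerivAt (f := fun s => X s - x s)
        (a := fun s => deriv X s - u s • unitField B (X s))
        (b := fun s => u s • unitField B (X s) - h s • unitField B (x s)) hs.1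
        (hX.continuous_deriv.sub (huc.smul hbX))
        ((huc.smul hbX).sub (hx.continuous_velocity.smul hbx)) hz (fun r => ?_)
        (by simp [hX.position_zero, hx.position_zero])
        ((h₁ ω x₀ X hω hX s hs.1 fun r hr => hXD r (hsub r hr)).trans
          (hle _ hC₁ (by linarith)))
        (fun r hr => (le_max_left _ _).trans (hlip r (hsub r hr)))
      rw [sub_add_sub_cancel]
      exact (hX.hasDerivAt r).sub (hx.hasDerivAt_position r)
    · have h2 := h₂ ω x₀ X hω hX s hs.1 fun r hr => hXD r (hsub r hr)
      change ‖∫ s in (0 : ℝ)..s, _ - gyroAverage _ _ _ (u s)‖ ≤ _ at h2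
      simp only [hga] at h2
      refine norm_le_add_integral_of_hasDerivAt (f := fun s => u s - h s)
        (a := fun s => inner ℝ (deriv X s) (fderiv ℝ (unitField B) (X s) (deriv X s))
          - mirrorForce B ‖v₀‖ (X s, u s))
        (b := fun s => mirrorForce B ‖v₀‖ (X s, u s) - mirrorForce B ‖v₀‖ (x s, h s)) hs.1
        (hVA.sub hmX) (hmX.sub hmx) hz (fun r => ?_)
        (by simp [hu, hX.position_zero, hX.velocity_zero, hx.velocity_zero])
        (h2.trans (hle _ hC₂ (by linarith)))
        (fun r hr => (le_max_right _ _).trans (hlip r (hsub r hr)))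
      rw [sub_add_sub_cancel]
      exact (hX.hasDerivAt_parallel (hb1.differentiable one_ne_zero) r).sub
        (hx.hasDerivAt_velocity r)
  refine (le_mul_exp_of_le_add_integral hz (fun _ => norm_nonneg _) hL ht key).trans ?_
  -- Moves the linear growth of the averaging error into the exponential, so that one constant
  -- suffices.
  have he : 1 + t ≤ Real.exp t := by linarith [Real.add_one_le_exp t]
  have hK0 : (0 : ℝ) ≤ K := K.2
  calc (C₁ + C₂) * (1 + t) / ω * Real.exp ((K + 1) * t)
      ≤ (C₁ + C₂) * Real.exp t / ω * Real.exp ((K + 1) * t) := by gcongr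
    _ = (C₁ + C₂) / ω * Real.exp ((K + 2) * t) := by
        rw [show ((K : ℝ) + 2) * t = t + (K + 1) * t by ring, Real.exp_add]; ring
    _ ≤ (C₁ + C₂ + K + 2) / ω * Real.exp ((C₁ + C₂ + K + 2) * t) := by
        have h3 : C₁ + C₂ ≤ C₁ + C₂ + K + 2 := by linarith
        have h4 : (K : ℝ) + 2 ≤ C₁ + C₂ + K + 2 := by linarith
        exact mul_le_mul (div_le_div_of_nonneg_right h3 hω.le)
          (Real.exp_le_exp.2 (mul_le_mul_of_nonneg_right h4 ht)) (Real.exp_nonneg _)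
          (by positivity)

theorem mem_closedBall (hx : IsGuidingCenter B x₀ v₀ x h) (hB0 : ∀ y, B y ≠ 0) {T s : ℝ}
    (hs : s ∈ Icc 0 T) : x s ∈ Metric.closedBall x₀ (‖v₀‖ * T) := by
  have := hx.norm_sub_le hB0 s 0
  rw [hx.position_zero, sub_zero, abs_of_nonneg hs.1] at this
  rw [mem_closedBall_iff_norm]
  exact this.trans (mul_le_mul_of_nonneg_left hs.2 (norm_nonneg _))

theorem _root_.IsParticlePath.mem_closedBall (hX : IsParticlePath B ω x₀ v₀ X) {T s : ℝ}
    (hs : s ∈ Icc 0 T) : X s ∈ Metric.closedBall x₀ (‖v₀‖ * T) := by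
  have := hX.norm_sub_le s 0
  rw [hX.position_zero, sub_zero, abs_of_nonneg hs.1] at this
  rw [mem_closedBall_iff_norm]
  exact this.trans (mul_le_mul_of_nonneg_left hs.2 (norm_nonneg _))

/-- Interpolation: an increment `a` of `X - x` is bounded both by twice the sup distance, which
tends to zero, and by `2|v₀||s - t|`; write `a = a^(1-α) a^α`. -/
theorem tendstoHolderLoc (hx : IsGuidingCenter B x₀ v₀ x h) (hB : ContDiff ℝ 3 B)
    (hB0 : ∀ y, B y ≠ 0) (hdiv : ∀ y, divergence B y = 0) {X : ℝ → ℝ → E3}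
    (hX : ∀ ω, 0 < ω → IsParticlePath B ω x₀ v₀ (X ω)) : TendstoHolderLoc X x := by
  intro α hα T hT ε hε
  obtain ⟨C, hC, hle⟩ := hx.exists_norm_sub_le hB hB0 hdiv
    (isCompact_closedBall x₀ (‖v₀‖ * T))
  have hα' : (0 : ℝ) < 1 - α := sub_pos.2 (by exact_mod_cast hα)
  have hδ : Tendsto (fun ω : ℝ => C / ω * Real.exp (C * T)) atTop (𝓝 0) := by
    simpa using (tendsto_const_nhds.div_atTop tendsto_id).mul_const (Real.exp (C * T))
  have hη : Tendsto (fun ω : ℝ => (2 * (C / ω * Real.exp (C * T))) ^ (1 - α : ℝ)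
      * (2 * ‖v₀‖) ^ (α : ℝ)) atTop (𝓝 0) := by
    have := ((hδ.const_mul 2).rpow_const (Or.inr hα'.le)).mul_const ((2 * ‖v₀‖) ^ (α : ℝ))
    simpa [Real.zero_rpow hα'.ne'] using this
  filter_upwards [hδ.eventually (gt_mem_nhds hε), hη.eventually (gt_mem_nhds hε),
    eventually_gt_atTop 0] with ω h1 h2 hω
  have hXω := hX ω hω
  have hsup : ∀ t ∈ Icc 0 T, ‖X ω t - x t‖ ≤ C / ω * Real.exp (C * T) := fun t ht => by
    refine ((le_max_left _ _).trans (hle ω (X ω) hω hXω t ht.1 (fun s hs => ?_)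
      fun s hs => ?_)).trans ?_
    · exact hXω.mem_closedBall ⟨hs.1, hs.2.trans ht.2⟩
    · exact hx.mem_closedBall hB0 ⟨hs.1, hs.2.trans ht.2⟩
    · gcongr
      exact ht.2
  refine ⟨fun t ht => (hsup t ht).trans h1.le, fun s hs t ht => ?_⟩
  set a := ‖(X ω s - x s) - (X ω t - x t)‖ with ha
  have ha1 : a ≤ 2 * (C / ω * Real.exp (C * T)) := by
    linarith [_root_.norm_sub_le (X ω s - x s) (X ω t - x t), hsup s hs, hsup t ht]
  have ha2 : a ≤ 2 * ‖v₀‖ * |s - t| := by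
    have e : (X ω s - x s) - (X ω t - x t) = (X ω s - X ω t) - (x s - x t) := by abel
    rw [ha, e]
    linarith [_root_.norm_sub_le (X ω s - X ω t) (x s - x t), hXω.norm_sub_le s t,
      hx.norm_sub_le hB0 s t]
  have ha0 : 0 ≤ a := norm_nonneg _
  have hfin : a ≤ ε * |s - t| ^ (α : ℝ) :=
    calc a = a ^ (1 - α : ℝ) * a ^ (α : ℝ) := by
          rw [← Real.rpow_add' ha0 (by simp), sub_add_cancel, Real.rpow_one]
      _ ≤ (2 * (C / ω * Real.exp (C * T))) ^ (1 - α : ℝ) * (2 * ‖v₀‖ * |s - t|) ^ (α : ℝ) := by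
          gcongr
      _ = (2 * (C / ω * Real.exp (C * T))) ^ (1 - α : ℝ) * (2 * ‖v₀‖) ^ (α : ℝ)
          * |s - t| ^ (α : ℝ) := by
          rw [Real.mul_rpow (by positivity) (abs_nonneg _), mul_assoc]
      _ ≤ ε * |s - t| ^ (α : ℝ) := mul_le_mul_of_nonneg_right h2.le (by positivity)
  rw [edist_dist, edist_dist, dist_eq_norm, Real.dist_eq,
    ENNReal.ofReal_rpow_of_nonneg (abs_nonneg _) α.coe_nonneg, ← ENNReal.ofReal_coe_nnreal,
    ← ENNReal.ofReal_mul ε.coe_nonneg]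
  exact ENNReal.ofReal_le_ofReal hfin

end IsGuidingCenter

end Comparison

/-! ### Invariance of the domain under tangent fields. -/

namespace IsLocalDefiningFunction

variable {k : ℕ} {Ω U : Set E3} {z : E3} {ρ : E3 → ℝ}

/-- If `ρ` increases at unit rate along `w` near `z`, a point of `Ω` close to `z` can be moved
to the boundary by following `w` over a distance at most `2|ρ|`. -/
theorem exists_frontier_near (hρ : IsLocalDefiningFunction 2 Ω z U ρ) (hΩ : IsOpen Ω)
    (hz : ρ z = 0) {w : E3} (hw : fderiv ℝ ρ z w = 1) {V : Set E3} (hV : V ∈ 𝓝 z) :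
    ∃ W ∈ 𝓝 z, ∀ y ∈ W, ρ y < 0 → ∃ s ∈ Icc 0 (2 * -ρ y),
      y ∈ V ∧ y + s • w ∈ V ∧ y + s • w ∈ frontier Ω ∩ U := by
  have hUz : U ∈ 𝓝 z := hρ.isOpen.mem_nhds hρ.mem
  have hcd : ContinuousOn (fun y => fderiv ℝ ρ y w) U :=
    ((hρ.contDiffOn.continuousOn_fderiv_of_isOpen hρ.isOpen (by norm_num)).clm_apply
      continuousOn_const)
  have hev : ∀ᶠ y in 𝓝 z, (1 / 2 : ℝ) < fderiv ℝ ρ y w :=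
    (hcd.continuousAt hUz).eventually (lt_mem_nhds (by simp only [hw]; norm_num))
  obtain ⟨r, hr, hball⟩ := Metric.mem_nhds_iff.1 (inter_mem (inter_mem hUz hV) hev)
  have hdiff : ∀ y ∈ U, HasFDerivAt ρ (fderiv ℝ ρ y) y := fun y hy =>
    ((hρ.contDiffOn.differentiableOn (by norm_num) y hy).differentiableAt
      (hρ.isOpen.mem_nhds hy)).hasFDerivAt
  have hcρ : ContinuousAt ρ z := (hdiff z hρ.mem).continuousAt
  have hc1 : ContinuousAt (fun y => ‖y - z‖ + 2 * -ρ y * ‖w‖) z := by fun_prop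
  have hW : ∀ᶠ y in 𝓝 z, ‖y - z‖ + 2 * -ρ y * ‖w‖ < r :=
    hc1.eventually (gt_mem_nhds (by simpa [hz] using hr))
  refine ⟨_, hW, fun y hy hneg => ?_⟩
  have hy : ‖y - z‖ + 2 * -ρ y * ‖w‖ < r := hy
  -- Near `z` the slope of `ρ` along `w` exceeds `1/2`, so `ρ` climbs from `ρ y` to zero within this
  -- time.
  set S := 2 * -ρ y with hS
  have hS0 : 0 < S := by linarith
  have hin : ∀ s ∈ Icc 0 S, y + s • w ∈ Metric.ball z r := fun s hs => by
    rw [mem_ball_iff_norm, add_sub_right_comm]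
    refine lt_of_le_of_lt ((norm_add_le _ _).trans ?_) hy
    rw [norm_smul, Real.norm_of_nonneg hs.1]
    gcongr
    exact hs.2
  have hd : ∀ s ∈ Icc 0 S, HasDerivAt (fun s : ℝ => ρ (y + s • w))
      (fderiv ℝ ρ (y + s • w) w) s := fun s hs => by
    have h1 : HasDerivAt (fun s : ℝ => y + s • w) w s := by
      simpa using ((hasDerivAt_id s).smul_const w).const_add y
    exact (hdiff _ (hball (hin s hs)).1.1).comp_hasDerivAt s h1
  have hcont : ContinuousOn (fun s : ℝ => ρ (y + s • w)) (Icc 0 S) :=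
    fun s hs => (hd s hs).continuousAt.continuousWithinAt
  have hinc : ∀ a ∈ Icc 0 S, ∀ b ∈ Icc 0 S, a ≤ b →
      1 / 2 * (b - a) ≤ ρ (y + b • w) - ρ (y + a • w) :=
    (convex_Icc 0 S).mul_sub_le_image_sub_of_le_deriv hcont
      (fun s hs => (hd s (interior_subset hs)).differentiableAt.differentiableWithinAt)
      (fun s hs => by
        rw [(hd s (interior_subset hs)).deriv]
        exact le_of_lt (hball (hin s (interior_subset hs))).2)
  have h0 : (0 : ℝ) ∈ Icc 0 S := ⟨le_rfl, hS0.le⟩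
  have hSS : S ∈ Icc 0 S := ⟨hS0.le, le_rfl⟩
  obtain ⟨s, hs, hs0⟩ : (0 : ℝ) ∈ (fun s : ℝ => ρ (y + s • w)) '' Icc 0 S := by
    refine intermediate_value_Icc hS0.le hcont ⟨by simpa using hneg.le, ?_⟩
    have := hinc 0 h0 S hSS hS0.le
    simp only [zero_smul, add_zero] at this
    linarith
  have hs0 : ρ (y + s • w) = 0 := hs0
  have hsne : 0 < s := by
    rcases hs.1.eq_or_lt with h | h
    · rw [← h, zero_smul, add_zero] at hs0; linarith
    · exact h
  have hmem := hball (hin s hs)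
  refine ⟨s, hs, ?_, hmem.1.2, ?_, hmem.1.1⟩
  · have := (hball (hin 0 h0)).1.2
    simpa using this
  · rw [hΩ.frontier_eq]
    refine ⟨?_, fun h => ?_⟩
    · refine mem_closure_of_tendsto (b := 𝓝[<] s) (f := fun s' : ℝ => y + s' • w) ?_ ?_
      · have : ContinuousAt (fun s' : ℝ => y + s' • w) s := by fun_prop
        exact this.tendsto.mono_left nhdsWithin_le_nhds
      · filter_upwards [Ioo_mem_nhdsLT hsne] with s' hs'
        have hs'' : s' ∈ Icc 0 S := ⟨hs'.1.le, hs'.2.le.trans hs.2⟩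
        have h3 := hinc s' hs'' s hs hs'.2.le
        have h4 : y + s' • w ∈ Ω ∩ U := by
          rw [hρ.inter_eq]
          exact ⟨(hball (hin s' hs'')).1.1, by linarith [hs'.2]⟩
        exact h4.1
    · have h4 : y + s • w ∈ Ω ∩ U := ⟨h, hmem.1.1⟩
      rw [hρ.inter_eq] at h4
      exact h4.2.ne hs0

theorem eq_zero_of_mem_frontier (hρ : IsLocalDefiningFunction k Ω z U ρ) (hΩ : IsOpen Ω)
    (hz : z ∈ frontier Ω) : ρ z = 0 := by
  rw [hΩ.frontier_eq] at hz
  have hc : ContinuousAt ρ z := hρ.contDiffOn.continuousOn.continuousAt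
    (hρ.isOpen.mem_nhds hρ.mem)
  refine le_antisymm ?_ (not_lt.1 fun h => ?_)
  · by_contra! h
    have h1 := hc.eventually (lt_mem_nhds h)
    obtain ⟨y, hy, hyΩ⟩ := mem_closure_iff_nhds.1 hz.1 _
      (inter_mem h1 (hρ.isOpen.mem_nhds hρ.mem))
    have h2 : y ∈ Ω ∩ U := ⟨hyΩ, hy.2⟩
    rw [hρ.inter_eq] at h2
    exact lt_asymm h2.2 hy.1
  · have h2 : z ∈ {y ∈ U | ρ y < 0} := ⟨hρ.mem, h⟩
    rw [← hρ.inter_eq] at h2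
    exact hz.2 h2.1

theorem of_le_of_mem {l : ℕ} (hρ : IsLocalDefiningFunction k Ω z U ρ) (hl : l ≤ k) {y : E3}
    (hy : y ∈ U) : IsLocalDefiningFunction l Ω y U ρ :=
  ⟨hρ.isOpen, hy, hρ.contDiffOn.of_le (by exact_mod_cast hl), hρ.fderiv_ne_zero, hρ.inter_eq⟩

/-- Along a tangent field the defining function is controlled by itself. -/
theorem exists_abs_fderiv_le (hρ : IsLocalDefiningFunction 2 Ω z U ρ) (hΩ : IsOpen Ω)
    (hz : z ∈ frontier Ω) {F : E3 → E3} (hF : ContDiff ℝ 1 F) (hFt : IsTangentToBoundary Ω F) :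
    ∃ C : ℝ, ∀ᶠ y in 𝓝 z, ρ y < 0 → |fderiv ℝ ρ y (F y)| ≤ C * |ρ y| := by
  have hz0 := hρ.eq_zero_of_mem_frontier hΩ hz
  obtain ⟨w', hw'⟩ : ∃ w', fderiv ℝ ρ z w' ≠ 0 := by
    by_contra! h
    exact hρ.fderiv_ne_zero z hρ.mem (ContinuousLinearMap.ext h)
  set w := (fderiv ℝ ρ z w')⁻¹ • w' with hw
  have hw1 : fderiv ℝ ρ z w = 1 := by
    rw [hw, map_smul, smul_eq_mul, inv_mul_cancel₀ hw']
  -- This function vanishes on the boundary and is locally Lipschitz, hence is bounded by the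
  -- distance to a boundary point along `w`, itself at most a multiple of `|ρ|`.
  have hq : ContDiffAt ℝ 1 (fun y => fderiv ℝ ρ y (F y)) z := by
    have h1 : ContDiffAt ℝ 2 ρ z := hρ.contDiffOn.contDiffAt (hρ.isOpen.mem_nhds hρ.mem)
    exact (h1.fderiv_right (by norm_num)).clm_apply hF.contDiffAt
  obtain ⟨K, V, hV, hK⟩ := hq.exists_lipschitzOnWith
  obtain ⟨W, hW, h⟩ := hρ.exists_frontier_near hΩ hz0 hw1 hV
  refine ⟨K * (2 * ‖w‖), ?_⟩
  filter_upwards [hW] with y hy hneg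
  obtain ⟨s, hs, hyV, hysV, hfr, hU⟩ := h y hy hneg
  have h0 : fderiv ℝ ρ (y + s • w) (F (y + s • w)) = 0 :=
    hFt _ hfr U ρ (hρ.of_le_of_mem one_le_two hU)
  have h1 := hK.norm_sub_le hyV hysV
  rw [h0, sub_zero, sub_add_cancel_left, norm_neg, norm_smul, Real.norm_of_nonneg hs.1,
    Real.norm_eq_abs] at h1
  refine h1.trans ?_
  rw [abs_of_neg hneg, mul_assoc]
  have := hs.2
  have h3 : s * ‖w‖ ≤ 2 * -ρ y * ‖w‖ := by gcongr
  calc (K : ℝ) * (s * ‖w‖) ≤ K * (2 * -ρ y * ‖w‖) := by gcongr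
    _ = _ := by ring

end IsLocalDefiningFunction

/-- Field lines of a tangent field do not leave the domain. -/
theorem mem_of_isTangentToBoundary {Ω : Set E3} (hΩ : IsOpen Ω) (hbd : HasCkBoundary 3 Ω)
    {F : E3 → E3} (hF : ContDiff ℝ 1 F) (hFt : IsTangentToBoundary Ω F) {x : ℝ → E3} {g : ℝ → ℝ}
    {M : ℝ} (hg : ∀ t, |g t| ≤ M) (hx : ∀ t, HasDerivAt x (g t • F (x t)) t) (h0 : x 0 ∈ Ω)
    {t : ℝ} (ht : 0 ≤ t) : x t ∈ Ω := by
  by_contra hcon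
  have hxc : Continuous x := continuous_iff_continuousAt.2 fun t => (hx t).continuousAt
  set A := {s : ℝ | 0 ≤ s ∧ x s ∉ Ω} with hA
  have hAc : IsClosed A :=
    (isClosed_le continuous_const continuous_id).inter (hΩ.isClosed_compl.preimage hxc)
  have hAne : A.Nonempty := ⟨t, ht, hcon⟩
  have hAb : BddBelow A := ⟨0, fun s hs => hs.1⟩
  -- The first exit time.
  set τ := sInf A with hτ
  have hτA : τ ∈ A := hAc.csInf_mem hAne hAb
  have hbefore : ∀ s, 0 ≤ s → s < τ → x s ∈ Ω := fun s hs0 hs => by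
    by_contra h
    exact absurd (csInf_le hAb (⟨hs0, h⟩ : s ∈ A)) (not_le.2 hs)
  have hτ0 : 0 < τ := by
    rcases hτA.1.eq_or_lt with h | h
    · exact absurd h0 (by rw [h]; exact hτA.2)
    · exact h
  have hfr : x τ ∈ frontier Ω := by
    rw [hΩ.frontier_eq]
    refine ⟨mem_closure_of_tendsto (b := 𝓝[<] τ)
      (hxc.continuousAt.tendsto.mono_left nhdsWithin_le_nhds) ?_, hτA.2⟩
    filter_upwards [Ioo_mem_nhdsLT hτ0] with s hs using hbefore s hs.1.le hs.2
  obtain ⟨U, ρ, hρ⟩ := hbd _ hfr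
  have hρ2 := hρ.of_le_of_mem (l := 2) (by norm_num) hρ.mem
  obtain ⟨C, hC⟩ := hρ2.exists_abs_fderiv_le hΩ hfr hF hFt
  have hev : ∀ᶠ s in 𝓝 τ, x s ∈ U ∧ (ρ (x s) < 0 → |fderiv ℝ ρ (x s) (F (x s))| ≤ C * |ρ (x s)|) :=
    hxc.continuousAt.eventually ((hρ.isOpen.eventually_mem hρ.mem).and hC)
  obtain ⟨δ, hδ, hball⟩ := Metric.eventually_nhds_iff.1 hev
  obtain ⟨η, hη0, hηδ, hητ⟩ : ∃ η, 0 < η ∧ η < δ ∧ η < τ :=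
    ⟨min δ τ / 2, by positivity, by linarith [min_le_left δ τ, lt_min hδ hτ0],
      by linarith [min_le_right δ τ, lt_min hδ hτ0]⟩
  have hnear : ∀ s ∈ Icc 0 η, x (τ - s) ∈ U ∧
      (ρ (x (τ - s)) < 0 → |fderiv ℝ ρ (x (τ - s)) (F (x (τ - s)))| ≤ C * |ρ (x (τ - s))|) :=
    fun s hs => hball (by
      rw [Real.dist_eq, sub_sub_cancel_left, abs_neg, abs_of_nonneg hs.1]
      exact hs.2.trans_lt hηδ)
  have hneg : ∀ s ∈ Ioc 0 η, ρ (x (τ - s)) < 0 := fun s hs => by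
    have h1 : x (τ - s) ∈ Ω ∩ U :=
      ⟨hbefore _ (by linarith [hs.2]) (by linarith [hs.1]), (hnear s ⟨hs.1.le, hs.2⟩).1⟩
    rw [hρ.inter_eq] at h1
    exact h1.2
  have hρτ : ρ (x τ) = 0 := hρ.eq_zero_of_mem_frontier hΩ hfr
  have hFτ : fderiv ℝ ρ (x τ) (F (x τ)) = 0 :=
    hFt _ hfr U ρ (hρ.of_le_of_mem (by norm_num) hρ.mem)
  have hd : ∀ s ∈ Icc 0 η, HasDerivAt (fun s => ρ (x (τ - s)))
      (-(g (τ - s) * fderiv ℝ ρ (x (τ - s)) (F (x (τ - s))))) s := fun s hs => by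
    have hUs := (hnear s hs).1
    have h1 : HasFDerivAt ρ (fderiv ℝ ρ (x (τ - s))) (x (τ - s)) :=
      ((hρ.contDiffOn.differentiableOn (by norm_num) _ hUs).differentiableAt
        (hρ.isOpen.mem_nhds hUs)).hasFDerivAt
    have h2 : HasDerivAt (fun s => x (τ - s)) (-(g (τ - s) • F (x (τ - s)))) s :=
      (hx (τ - s)).comp_const_sub τ s
    have h3 := h1.comp_hasDerivAt s h2
    rwa [map_neg, map_smul, smul_eq_mul] at h3
  -- Gronwall backwards in time from `τ`: `ρ(x)` vanishes at `τ`, hence just before it too, where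
  -- `x` is in `Ω` and `ρ(x) < 0`.
  have hzero := eq_zero_of_abs_deriv_le_mul_abs_self_of_eq_zero_right
    (f := fun s => ρ (x (τ - s))) (K := M * C) (a := 0) (b := η)
    (fun s hs => (hd s hs).continuousAt.continuousWithinAt)
    (fun s hs => (hd s (Ico_subset_Icc_self hs)).hasDerivWithinAt) (by simpa using hρτ)
    (fun s hs => by
      have hM0 : 0 ≤ M := (abs_nonneg _).trans (hg 0)
      rw [norm_neg, norm_mul, Real.norm_eq_abs, Real.norm_eq_abs, Real.norm_eq_abs]
      rcases hs.1.eq_or_lt with h | h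
      · rw [← h, sub_zero, hFτ, hρτ]; simp
      · rw [mul_assoc]
        exact mul_le_mul (hg _) ((hnear s (Ico_subset_Icc_self hs)).2 (hneg s ⟨h, hs.2.le⟩))
          (abs_nonneg _) hM0)
  exact (hneg η ⟨hη0, le_rfl⟩).ne (hzero η ⟨hη0.le, le_rfl⟩)

/-! ### The pressure along particle paths. -/

/-- The mean of the quadratic form `D(perpCurrent B)` in an equilibrium, for a particle of speed
`r` at `q.1` with parallel velocity `q.2`. -/
noncomputable def meanDrift (B : E3 → E3) (r : ℝ) (q : E3 × ℝ) : ℝ :=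
  (r ^ 2 * ‖B q.1‖⁻¹ - (r ^ 2 - q.2 ^ 2) / 2 * ‖B q.1‖⁻¹) *
    (‖B q.1‖⁻¹ ^ 3 * inner ℝ (B q.1) (fderiv ℝ B q.1 (cross (B q.1) (lorentzForce B q.1))))

theorem contDiff_meanDrift {B : E3 → E3} (hB : ContDiff ℝ 3 B) (hB0 : ∀ y, B y ≠ 0) (r : ℝ) :
    ContDiff ℝ 1 (meanDrift B r) := by
  have hB1 : ContDiff ℝ 1 B := hB.of_le (by norm_num)
  have hi := contDiff_inv_norm hB1 hB0
  have hi1 : ContDiff ℝ 1 fun q : E3 × ℝ => ‖B q.1‖⁻¹ := hi.comp contDiff_fst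
  have hQ : ContDiff ℝ 1 fun y =>
      ‖B y‖⁻¹ ^ 3 * inner ℝ (B y) (fderiv ℝ B y (cross (B y) (lorentzForce B y))) :=
    (hi.pow 3).mul (hB1.inner ℝ ((hB.fderiv_right (by norm_num)).clm_apply
      (hB1.cross ((contDiff_lorentzForce hB).of_le one_le_two))))
  exact ((contDiff_const.mul hi1).sub
    (((contDiff_const.sub (contDiff_snd.pow 2)).div_const 2).mul hi1)).mul
    (hQ.comp contDiff_fst)

namespace IsPlasmaEquilibrium

variable {Ω : Set E3} {B : E3 → E3} {p : E3 → ℝ}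

theorem hasFDerivAt (heq : IsPlasmaEquilibrium Ω B p) (hΩ : IsOpen Ω)
    (hp : ContDiffOn ℝ 3 p (closure Ω)) {y : E3} (hy : y ∈ Ω) :
    HasFDerivAt p (innerSL ℝ (lorentzForce B y)) y := by
  have hd : DifferentiableAt ℝ p y :=
    ((hp.mono subset_closure).contDiffAt (hΩ.mem_nhds hy)).differentiableAt (by norm_num)
  have h1 := hd.hasGradientAt.hasFDerivAt
  rw [← heq.force_balance y hy] at h1
  exact h1

/-- In `Ω` the force is `∇p`, so its derivative is the Hessian of `p`. -/
theorem fderiv_lorentzForce_symm (heq : IsPlasmaEquilibrium Ω B p) (hΩ : IsOpen Ω)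
    (hp : ContDiffOn ℝ 3 p (closure Ω)) (hB : ContDiff ℝ 3 B) {y : E3} (hy : y ∈ Ω) (v w : E3) :
    inner ℝ (fderiv ℝ (lorentzForce B) y v) w = inner ℝ (fderiv ℝ (lorentzForce B) y w) v := by
  have hpy : ContDiffAt ℝ 3 p y := (hp.mono subset_closure).contDiffAt (hΩ.mem_nhds hy)
  have hsymm := hpy.isSymmSndFDerivAt (by simp [minSmoothness_of_isRCLikeNormedField]; norm_num)
  have hP : DifferentiableAt ℝ (lorentzForce B) y :=
    (contDiff_lorentzForce hB).differentiable (by norm_num) y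
  have hD : DifferentiableAt ℝ (fderiv ℝ p) y :=
    (hpy.fderiv_right (m := 1) (by norm_num)).differentiableAt one_ne_zero
  have key : ∀ v w, fderiv ℝ (fderiv ℝ p) y v w = inner ℝ (fderiv ℝ (lorentzForce B) y v) w := by
    intro v w
    have h1 : HasFDerivAt (fun z => fderiv ℝ p z w) _ y :=
      hD.hasFDerivAt.clm_apply (hasFDerivAt_const w y)
    have h2 : HasFDerivAt (fun z => (inner ℝ (lorentzForce B z) w : ℝ)) _ y :=
      hP.hasFDerivAt.inner ℝ (hasFDerivAt_const w y)
    have h3 : (fun z => fderiv ℝ p z w) =ᶠ[𝓝 y] fun z => (inner ℝ (lorentzForce B z) w : ℝ) := by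
      filter_upwards [hΩ.mem_nhds hy] with z hz
      rw [(heq.hasFDerivAt hΩ hp hz).fderiv, innerSL_apply_apply]
    have h4 := (h2.congr_of_eventuallyEq h3).unique h1
    have h5 := congrArg (fun l : E3 →L[ℝ] ℝ => l v) h4
    simpa using h5.symm
  rw [← key, ← key]
  exact hsymm.eq v w

theorem gyroAverage_eq (heq : IsPlasmaEquilibrium Ω B p) (hΩ : IsOpen Ω)
    (hp : ContDiffOn ℝ 3 p (closure Ω)) (hB : ContDiff ℝ 3 B) (hB0 : ∀ y, B y ≠ 0) {y : E3}
    (hy : y ∈ Ω) (r u : ℝ) :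
    gyroAverage (fderiv ℝ (perpCurrent B) y) (unitField B y) r u = meanDrift B r (y, u) := by
  have hBd := hB.differentiable (by norm_num) y
  have hn : ‖B y‖ ≠ 0 := norm_ne_zero_iff.2 (hB0 y)
  rw [gyroAverage_fderiv_perpCurrent hBd (hB0 y)
    ((contDiff_lorentzForce hB).differentiable (by norm_num) y)
    (heq.fderiv_lorentzForce_symm hΩ hp hB hy), gradient_inv_norm_field hBd (hB0 y), meanDrift]
  field_simp

/-- Conservation of the moment allows `μ₀` to be replaced by the moment at time `s`, a function of
`(x s, h s)`. -/
theorem driftDensity_eq (heq : IsPlasmaEquilibrium Ω B p) (hB : ContDiff ℝ 3 B)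
    (hB0 : ∀ y, B y ≠ 0) {x₀ v₀ : E3} {x : ℝ → E3} {h : ℝ → ℝ}
    (hx : IsGuidingCenter B x₀ v₀ x h) {s : ℝ} (hs : x s ∈ Ω) :
    driftDensity B p v₀ (magneticMoment B v₀ x h 0) (x s) = -meanDrift B ‖v₀‖ (x s, h s) := by
  have hn : ‖B (x s)‖ ≠ 0 := norm_ne_zero_iff.2 (hB0 _)
  rw [driftDensity, ← hx.moment_eq s, magneticMoment, ← heq.force_balance _ hs,
    gradient_inv_norm_field (hB.differentiable (by norm_num) _) (hB0 _), meanDrift, lorentzForce]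
  field_simp

theorem gyroTerm_eq (heq : IsPlasmaEquilibrium Ω B p) {y : E3} (hy : y ∈ Ω) (v : E3) :
    gyroTerm B p y v = inner ℝ (perpCurrent B y) v := by
  rw [gyroTerm, ← heq.force_balance y hy, inner_perpCurrent]
  rfl

/-- The pressure along a particle path, up to the exact oscillating term. -/
theorem pressure_sub_eq (heq : IsPlasmaEquilibrium Ω B p) (hΩ : IsOpen Ω)
    (hp : ContDiffOn ℝ 3 p (closure Ω)) (hB : ContDiff ℝ 3 B) (hB0 : ∀ y, B y ≠ 0) {ω : ℝ}
    {x₀ v₀ : E3} {X : ℝ → E3} (hX : IsParticlePath B ω x₀ v₀ X) {t : ℝ} (ht : 0 ≤ t)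
    (hXΩ : ∀ s ∈ Icc 0 t, X s ∈ Ω) :
    ω * (p (X t) - p x₀) = inner ℝ (perpCurrent B (X t)) (deriv X t)
      - inner ℝ (perpCurrent B x₀) v₀
      - ∫ s in (0 : ℝ)..t, inner ℝ (deriv X s) (fderiv ℝ (perpCurrent B) (X s) (deriv X s)) := by
  have hK := contDiff_perpCurrent hB hB0
  have hcont : Continuous fun s =>
      (inner ℝ (deriv X s) (fderiv ℝ (perpCurrent B) (X s) (deriv X s)) : ℝ) :=
    hX.continuous_deriv.inner (((hK.continuous_fderiv (by norm_num)).comp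
      hX.continuous).clm_apply hX.continuous_deriv)
  -- In `K·V - ω p(X)` the terms of order `ω` cancel.
  have hd : ∀ s ∈ uIcc 0 t, HasDerivAt
      (fun s => inner ℝ (perpCurrent B (X s)) (deriv X s) - ω * p (X s))
      (inner ℝ (deriv X s) (fderiv ℝ (perpCurrent B) (X s) (deriv X s))) s := fun s hs => by
    rw [uIcc_of_le ht] at hs
    have h1 := ((heq.hasFDerivAt hΩ hp (hXΩ s hs)).comp_hasDerivAt s
      (hX.hasDerivAt s)).const_mul ω
    have h2 := (((hK.differentiable (by norm_num)) (X s)).hasFDerivAt.comp_hasDerivAt s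
      (hX.hasDerivAt s)).inner ℝ (hX.equation s)
    simp only [Function.comp_apply, real_inner_smul_right, inner_perpCurrent_cross hB0] at h2
    have h3 := h2.sub h1
    rw [innerSL_apply_apply, add_sub_cancel_left, real_inner_comm] at h3
    exact h3
  rw [intervalIntegral.integral_eq_sub_of_hasDerivAt hd (hcont.intervalIntegrable _ _),
    hX.position_zero, hX.velocity_zero]
  ring

end IsPlasmaEquilibrium

/-- With `A ≤ exp A` and `1 + t ≤ exp t` the left side is at most `exp (A + t + C t)`, and `t ≤ 1 +
t²` bounds this exponent by `(A + C + 1)(1 + t²)`. -/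
theorem one_add_mul_exp_le {A C t : ℝ} (hA : 0 ≤ A) (hC : 0 ≤ C) (ht : 0 ≤ t) :
    A * (1 + t) * Real.exp (C * t)
      ≤ Real.exp ((A + C + 1) * Real.exp ((A + C + 1) * t ^ 2)) := by
  have h1 : A ≤ Real.exp A := by linarith [Real.add_one_le_exp A]
  have h2 : 1 + t ≤ Real.exp t := by linarith [Real.add_one_le_exp t]
  have h3 := Real.add_one_le_exp ((A + C + 1) * t ^ 2)
  have h4 : t ^ 2 ≤ (A + C + 1) * t ^ 2 := by nlinarith [sq_nonneg t]
  calc A * (1 + t) * Real.exp (C * t) ≤ Real.exp A * Real.exp t * Real.exp (C * t) := by gcongr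
    _ = Real.exp (A + t + C * t) := by rw [Real.exp_add, Real.exp_add]
    _ ≤ _ := by
      gcongr
      have h5 : (A + C + 1) * (t ^ 2 + 1)
          ≤ (A + C + 1) * Real.exp ((A + C + 1) * t ^ 2) := by gcongr; linarith
      nlinarith [sq_nonneg (t - 1)]

/-- The displacement formula with an explicit rate, for a single initial state. -/
theorem IsPlasmaEquilibrium.exists_displacement_le {Ω : Set E3} {B : E3 → E3} {p : E3 → ℝ}
    (heq : IsPlasmaEquilibrium Ω B p) (hΩ : IsOpen Ω) (hΩb : Bornology.IsBounded Ω)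
    (hp : ContDiffOn ℝ 3 p (closure Ω)) (hB : ContDiff ℝ 3 B) (hB0 : ∀ y, B y ≠ 0)
    (hdiv : ∀ y, divergence B y = 0) {x₀ v₀ : E3} {x : ℝ → E3} {h : ℝ → ℝ}
    (hx : IsGuidingCenter B x₀ v₀ x h) (hxΩ : ∀ t, 0 ≤ t → x t ∈ Ω) :
    ∃ A C, 0 ≤ A ∧ 0 ≤ C ∧ ∀ (ω : ℝ) (X : ℝ → E3) (t : ℝ), 0 < ω → IsParticlePath B ω x₀ v₀ X →
      0 ≤ t → (∀ s ∈ Icc 0 t, X s ∈ Ω) →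
        |p (X t) - (p x₀ + gyroTerm B p (x t) (deriv X t) / ω - gyroTerm B p x₀ v₀ / ω
          + 1 / ω * ∫ s in (0 : ℝ)..t, driftDensity B p v₀ (magneticMoment B v₀ x h 0) (x s))|
        ≤ 1 / ω ^ 2 * (A * (1 + t) * Real.exp (C * t)) := by
  have hD : IsCompact (closure Ω) := hΩb.isCompact_closure
  have hB1 : ContDiff ℝ 1 B := hB.of_le (by norm_num)
  have hb1 := contDiff_unitField hB1 hB0
  have hK2 := contDiff_perpCurrent hB hB0
  have hDK : ContDiff ℝ 1 (fderiv ℝ (perpCurrent B)) := hK2.fderiv_right (by norm_num)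
  have hm := contDiff_meanDrift hB hB0 ‖v₀‖
  obtain ⟨C, hC, hcmp⟩ := hx.exists_norm_sub_le hB hB0 hdiv hD
  obtain ⟨C₁, hC₁, havg⟩ := exists_abs_integral_sub_gyroAverage_le hB1 hB0 hDK hD v₀
  obtain ⟨L₁, hL₁⟩ := (hK2.of_le one_le_two).exists_lipschitzOnWith_of_isCompact hD
  obtain ⟨L₂, hL₂⟩ := hm.exists_lipschitzOnWith_of_isCompact
    (hD.prod (isCompact_closedBall (0 : ℝ) ‖v₀‖))
  -- Three errors: `K` at `x t` instead of `X t`, the averaging of `V·DK(V)`, and the mean drift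
  -- along `x` instead of `X`.
  refine ⟨L₁ * C * ‖v₀‖ + C₁ + L₂ * C, C, by positivity, hC, fun ω X t hω hX ht hXΩ => ?_⟩
  set u : ℝ → ℝ := fun s => inner ℝ (unitField B (X s)) (deriv X s) with hu
  have huc : Continuous u := continuous_iff_continuousAt.2 fun s =>
    (hX.hasDerivAt_parallel (hb1.differentiable one_ne_zero) s).continuousAt
  have hx₀ : x₀ ∈ Ω := by simpa [hx.position_zero] using hxΩ 0 le_rfl
  have hdist : ∀ s ∈ Icc 0 t, ‖(X s, u s) - (x s, h s)‖ ≤ C / ω * Real.exp (C * t) :=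
    fun s hs => by
      refine (hcmp ω X hω hX s hs.1 (fun r hr => subset_closure (hXΩ r ⟨hr.1, hr.2.trans hs.2⟩))
        (fun r hr => subset_closure (hxΩ r hr.1))).trans ?_
      gcongr
      exact hs.2
  have hcq : Continuous fun s =>
      (inner ℝ (deriv X s) (fderiv ℝ (perpCurrent B) (X s) (deriv X s)) : ℝ) :=
    hX.continuous_deriv.inner ((hDK.continuous.comp hX.continuous).clm_apply hX.continuous_deriv)
  have hcX : Continuous fun s => meanDrift B ‖v₀‖ (X s, u s) :=
    hm.continuous.comp (hX.continuous.prodMk huc)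
  have hcx : Continuous fun s => meanDrift B ‖v₀‖ (x s, h s) :=
    hm.continuous.comp (hx.continuous.prodMk hx.continuous_velocity)
  have e1 : |∫ s in (0 : ℝ)..t,
      (inner ℝ (deriv X s) (fderiv ℝ (perpCurrent B) (X s) (deriv X s))
        - meanDrift B ‖v₀‖ (X s, u s))| ≤ C₁ * (1 + t) / ω := by
    have := havg ω x₀ X hω hX t ht fun s hs => subset_closure (hXΩ s hs)
    rw [Real.norm_eq_abs] at this
    refine le_trans (le_of_eq ?_) this
    congr 1
    refine intervalIntegral.integral_congr fun s hs => ?_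
    rw [uIcc_of_le ht] at hs
    rw [heq.gyroAverage_eq hΩ hp hB hB0 (hXΩ s hs)]
  have e2 : |∫ s in (0 : ℝ)..t, (meanDrift B ‖v₀‖ (X s, u s) - meanDrift B ‖v₀‖ (x s, h s))|
      ≤ L₂ * (C / ω * Real.exp (C * t)) * t := by
    have := intervalIntegral.norm_integral_le_of_norm_le_const (a := 0) (b := t)
      (C := L₂ * (C / ω * Real.exp (C * t)))
      (f := fun s => meanDrift B ‖v₀‖ (X s, u s) - meanDrift B ‖v₀‖ (x s, h s)) (fun s hs => by
        rw [uIoc_of_le ht] at hs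
        have hs' := Ioc_subset_Icc_self hs
        refine (hL₂.norm_sub_le
          ⟨subset_closure (hXΩ s hs'), by simpa using hX.abs_parallel_le hB0 s⟩
          ⟨subset_closure (hxΩ s hs'.1), by simpa using hx.abs_velocity_le s⟩).trans ?_
        gcongr
        exact hdist s hs')
    rwa [sub_zero, abs_of_nonneg ht, Real.norm_eq_abs] at this
  have e3 : |(inner ℝ (perpCurrent B (X t) - perpCurrent B (x t)) (deriv X t) : ℝ)|
      ≤ L₁ * (C / ω * Real.exp (C * t)) * ‖v₀‖ := by
    refine (abs_real_inner_le_norm _ _).trans ?_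
    rw [hX.norm_deriv]
    gcongr
    refine (hL₁.norm_sub_le (subset_closure (hXΩ t ⟨ht, le_rfl⟩))
      (subset_closure (hxΩ t ht))).trans ?_
    gcongr
    exact (le_max_left _ _).trans (hdist t ⟨ht, le_rfl⟩)
  have hdrift : ∫ s in (0 : ℝ)..t, driftDensity B p v₀ (magneticMoment B v₀ x h 0) (x s)
      = -∫ s in (0 : ℝ)..t, meanDrift B ‖v₀‖ (x s, h s) := by
    rw [← intervalIntegral.integral_neg]
    refine intervalIntegral.integral_congr fun s hs => ?_
    rw [uIcc_of_le ht] at hs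
    exact heq.driftDensity_eq hB hB0 hx (hxΩ s hs.1)
  have hpr := heq.pressure_sub_eq hΩ hp hB hB0 hX ht hXΩ
  rw [intervalIntegral.integral_sub (hcq.intervalIntegrable _ _)
    (hcX.intervalIntegrable _ _)] at e1
  rw [intervalIntegral.integral_sub (hcX.intervalIntegrable _ _)
    (hcx.intervalIntegrable _ _)] at e2
  rw [inner_sub_left] at e3
  rw [heq.gyroTerm_eq (hxΩ t ht), heq.gyroTerm_eq hx₀, hdrift]
  generalize (∫ s in (0 : ℝ)..t,
    inner ℝ (deriv X s) (fderiv ℝ (perpCurrent B) (X s) (deriv X s)) : ℝ) = I₁ at *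
  generalize (∫ s in (0 : ℝ)..t, meanDrift B ‖v₀‖ (X s, u s)) = I₂ at *
  generalize (∫ s in (0 : ℝ)..t, meanDrift B ‖v₀‖ (x s, h s)) = I₃ at *
  generalize (inner ℝ (perpCurrent B (X t)) (deriv X t) : ℝ) = G₁ at *
  generalize (inner ℝ (perpCurrent B (x t)) (deriv X t) : ℝ) = G₂ at *
  generalize (inner ℝ (perpCurrent B x₀) v₀ : ℝ) = G₀ at *
  have hR : p (X t) - (p x₀ + G₂ / ω - G₀ / ω + 1 / ω * -I₃)
      = 1 / ω * ((G₁ - G₂) - (I₁ - I₂) - (I₂ - I₃)) := by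
    field_simp
    linarith
  rw [hR, abs_mul, abs_of_pos (by positivity)]
  have hexp : 1 ≤ Real.exp (C * t) := Real.one_le_exp (by positivity)
  calc 1 / ω * |(G₁ - G₂) - (I₁ - I₂) - (I₂ - I₃)|
      ≤ 1 / ω * (L₁ * (C / ω * Real.exp (C * t)) * ‖v₀‖ + C₁ * (1 + t) / ω
        + L₂ * (C / ω * Real.exp (C * t)) * t) := by
        gcongr
        exact (abs_sub _ _).trans (add_le_add ((abs_sub _ _).trans (add_le_add e3 e1)) e2)
    _ = 1 / ω ^ 2 * (L₁ * C * ‖v₀‖ * 1 * Real.exp (C * t) + C₁ * (1 + t) * 1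
        + L₂ * C * t * Real.exp (C * t)) := by field_simp
    _ ≤ 1 / ω ^ 2 * (L₁ * C * ‖v₀‖ * (1 + t) * Real.exp (C * t)
        + C₁ * (1 + t) * Real.exp (C * t) + L₂ * C * (1 + t) * Real.exp (C * t)) := by
        gcongr <;> linarith
    _ = _ := by ring

theorem theorem1p5 (B : E3 → E3) (hB : IsBoundedCk 3 B) (hB0 : ∀ y, B y ≠ 0)
    (hdiv : ∀ y, divergence B y = 0)
    (Ω : Set E3) (hΩo : IsOpen Ω) (hΩc : IsConnected Ω) (hΩb : Bornology.IsBounded Ω)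
    (hΩ : HasCkBoundary 3 Ω)
    (p : E3 → ℝ) (hp : ContDiffOn ℝ 3 p (closure Ω)) (heq : IsPlasmaEquilibrium Ω B p) :
    ∃ c : ℝ, 0 < c ∧ ∀ x₀ ∈ Ω, ∀ v₀ : E3,
      (∀ ω : ℝ, 0 < ω → ∃! Y : ℝ → E3, IsParticlePath B ω x₀ v₀ Y) ∧
      ∀ X : ℝ → ℝ → E3, (∀ ω : ℝ, 0 < ω → IsParticlePath B ω x₀ v₀ (X ω)) →
        ∃ (x : ℝ → E3) (h : ℝ → ℝ), IsLimitTrajectory B X x h ∧ (∀ t, 0 ≤ t → x t ∈ Ω) ∧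
          ∃ C : ℝ, 0 < C ∧ ∀ ω t : ℝ, 0 < ω → 0 ≤ t → (∀ s ∈ Icc 0 t, X ω s ∈ Ω) →
            |p (X ω t) - (p x₀ + gyroTerm B p (x t) (deriv (X ω) t) / ω
                - gyroTerm B p x₀ v₀ / ω
                + 1 / ω * ∫ s in (0 : ℝ)..t, driftDensity B p v₀ (magneticMoment B v₀ x h 0) (x s))|
              ≤ c / ω ^ 2 * Real.exp (C * Real.exp (C * t ^ 2)) := by
  have hB3 : ContDiff ℝ 3 B := hB.1
  have hB1 : ContDiff ℝ 1 B := hB3.of_le (by norm_num)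
  obtain ⟨M₀, hM₀⟩ := hB.2 0 (by norm_num)
  obtain ⟨M₁, hM₁⟩ := hB.2 1 (by norm_num)
  simp only [norm_iteratedFDeriv_zero] at hM₀
  simp only [norm_iteratedFDeriv_one] at hM₁
  -- The constant `c` must not depend on the initial state, whereas `C` may; the prefactor is
  -- absorbed into the exponent, so `c = 1` works.
  refine ⟨1, one_pos, fun x₀ hx₀ v₀ => ⟨fun ω hω => ?_, fun X hX => ?_⟩⟩
  · obtain ⟨Y, hY⟩ := exists_particlePath hB1 hM₀ ω x₀ v₀
    exact ⟨Y, hY, fun Z hZ => hZ.unique hB1 hY⟩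
  obtain ⟨x, h, hx⟩ := exists_isGuidingCenter (hB3.of_le (by norm_num)) hB0 hM₁ x₀ v₀
  have htan : IsTangentToBoundary Ω (unitField B) := fun z hz U ρ hρ => by
    rw [unitField, map_smul, heq.field_tangent z hz U ρ hρ, smul_zero]
  have hxΩ : ∀ t, 0 ≤ t → x t ∈ Ω := fun t ht =>
    mem_of_isTangentToBoundary hΩo hΩ (contDiff_unitField hB1 hB0) htan hx.abs_velocity_le
      hx.hasDerivAt_position (by rwa [hx.position_zero]) ht
  obtain ⟨A, C, hA, hC, hdisp⟩ :=
    heq.exists_displacement_le hΩo hΩb hp hB3 hB0 hdiv hx hxΩ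
  refine ⟨x, h, ⟨hx.tendstoHolderLoc hB3 hB0 hdiv hX, fun t _ =>
    (hx.hasDerivAt_position t).hasDerivWithinAt⟩, hxΩ, A + C + 1, by positivity,
    fun ω t hω ht hXΩ => (hdisp ω (X ω) t hω (hX ω hω) ht hXΩ).trans ?_⟩
  gcongr
  exact one_add_mul_exp_le hA hC ht
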